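/- Let $\Lambda\subset\mathbb C^n$ be a lattice, $T=\mathbb C^n/\Lambda$ the corresponding complex torus, $p\colon\mathbb C^n\to T$ the projection, and let $G$ be a finite group acting faithfully and holomorphically on $T$. Let $$\Gamma=\{\gamma\colon\mathbb C^n\to\mathbb C^n \text{ a homeomorphism}\mid \exists\, g\in G:\ g\circ p=p\circ\gamma\}$$ be the group of lifts of elements of $G$, and $\pi\colon\Gamma\to G$ the homomorphism sending a lift of $g$ to $g$; its kernel is $\Lambda$, acting by translations. Let $G_{\mathrm{fix}}\le G$ and $\Gamma_{\mathrm{fix}}\le\Gamma$ be the (normal) subgroups generated by the elements having a fixed point on $T$ and on $\mathbb C^n$, respectively. Put $\Lambda'=\Lambda\cap\Gamma_{\mathrm{fix}}$ and let $T'=\mathbb C^n/\Lambda'$, a possibly non-compact torus. Then: 1. $\mathbb C^n/\Gamma_{\mathrm{fix}}$ is the universal cover of $T/G$: it is simply connected, and the natural map $\mathbb C^n/\Gamma_{\mathrm{fix}}\to T/G$ is a surjective covering map. Moreover, $\pi$ induces an isomorphism $\Gamma_{\mathrm{fix}}/\Lambda'\cong G_{\mathrm{fix}}$; through it the action of $\Gamma_{\mathrm{fix}}$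 on $\mathbb C^n$ induces an action of $G_{\mathrm{fix}}$ on $T'$; and there are isomorphisms $$\mathbb C^n/\Gamma_{\mathrm{fix}}\;\simeq\;(\mathbb C^n/\Lambda')/(\Gamma_{\mathrm{fix}}/\Lambda')\;\simeq\;T'/G_{\mathrm{fix}},$$ namely homeomorphisms induced by the identity of $\mathbb C^n$. 2. The universal cover $\mathbb C^n/\Gamma_{\mathrm{fix}}$ is compact if and only if $\Gamma_{\mathrm{fix}}$ is crystallographic (that is, after a complex linear change of coordinates of $\mathbb C^n$ it is a discrete cocompact subgroup of the Euclidean group of $\mathbb C^n=\mathbb R^{2n}$), and if and only if $T'$ is compact. 3. If there is an element $g\in G_{\mathrm{fix}}$ such that all lifts of $g$ to $\mathbb C^n$ belong to $\Gamma_{\mathrm{fix}}$, then $\Lambda\subset\Gamma_{\mathrm{fix}}$, and for every base point $$\pi_1(T/G)\cong G/G_{\mathrm{fix}}.$$ -/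

import Mathlib

open Topology

namespace TorusQuotient

/-! ### General notions -/

/-- Homeomorphisms of a space act on it by evaluation. -/
instance homeoAction (X : Type*) [TopologicalSpace X] : MulAction (X ≃ₜ X) X where
  smul γ x := γ x
  one_smul _ := rfl
  mul_smul _ _ _ := rfl

/-- The orbit space `X / H` (with the quotient topology). -/
abbrev OrbitSpace (H X : Type*) [Group H] [MulAction H X] : Type _ :=
  MulAction.orbitRel.Quotient H X

/-- The quotient map `X → X / H`. -/
def orbitMk (H : Type*) {X : Type*} [Group H] [MulAction H X] (x : X) : OrbitSpace H X :=
  Quotient.mk _ x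

/-- `q : Y → X` is a universal covering: a surjective covering map with simply connected
total space. -/
structure IsUniversalCover {Y X : Type*} [TopologicalSpace Y] [TopologicalSpace X]
    (q : Y → X) : Prop where
  simplyConnected : SimplyConnectedSpace Y
  isCoveringMap : IsCoveringMap q
  surjective : Function.Surjective q

section Crystallographic

variable (V : Type*) [NormedAddCommGroup V] [NormedSpace ℝ V]

/-- The Euclidean group of `V` is the group `V ≃ᵃⁱ[ℝ] V` of affine isometries `x ↦ A x + b`; its
topology is the one of the semidirect product `V ⋊ O(V)`, i.e. the topology induced by
`(x ↦ A x + b) ↦ (b, A)`. -/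
noncomputable instance euclideanGroupTopology : TopologicalSpace (V ≃ᵃⁱ[ℝ] V) :=
  TopologicalSpace.induced
    (fun φ => (φ 0, (φ.linearIsometryEquiv.toContinuousLinearEquiv : V →L[ℝ] V)))
    inferInstance

variable {V}

/-- A crystallographic group: a discrete cocompact subgroup of the Euclidean group. -/
def IsCrystallographic (D : Subgroup (V ≃ᵃⁱ[ℝ] V)) : Prop :=
  DiscreteTopology D ∧ CompactSpace ((V ≃ᵃⁱ[ℝ] V) ⧸ D)

end Crystallographic

/-- The space `ℂⁿ` with its Hermitian norm. -/
abbrev Cn (n : ℕ) : Type := EuclideanSpace ℂ (Fin n)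

/-- A group `S` of transformations of `ℂⁿ` is crystallographic if, after a complex linear change
of coordinates `A`, it is a crystallographic group of Euclidean motions of `ℂⁿ = ℝ²ⁿ`. -/
def IsCrystallographicGroup {n : ℕ} (S : Subgroup (Cn n ≃ₜ Cn n)) : Prop :=
  ∃ (A : Cn n ≃L[ℂ] Cn n) (D : Subgroup (Cn n ≃ᵃⁱ[ℝ] Cn n)), IsCrystallographic D ∧
    ∀ γ : Cn n ≃ₜ Cn n, γ ∈ S ↔ ∃ φ ∈ D, ∀ z, A (γ z) = φ (A z)

/-! ### Torus quotients -/

section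

variable {n : ℕ} (Λ : AddSubgroup (Cn n))

/-- A self-map `f` of `T = ℂⁿ / Λ` is holomorphic: locally on `ℂⁿ` it is given by holomorphic
maps `F`, that is, `f ∘ p = p ∘ F` with `p : ℂⁿ → T` the projection. -/
def IsHolomorphicMap (f : Cn n ⧸ Λ → Cn n ⧸ Λ) : Prop :=
  ∀ z : Cn n, ∃ U ∈ 𝓝 z, ∃ F : Cn n → Cn n, DifferentiableOn ℂ F U ∧
    ∀ w ∈ U, f (w : Cn n ⧸ Λ) = (F w : Cn n ⧸ Λ)

variable (G : Type*) [Group G] [MulAction G (Cn n ⧸ Λ)]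

variable {G} in
/-- `γ : ℂⁿ → ℂⁿ` is a lift of (the automorphism of `T` given by) `g`: `g ∘ p = p ∘ γ`. -/
def IsLift (g : G) (γ : Cn n ≃ₜ Cn n) : Prop :=
  ∀ z : Cn n, g • (z : Cn n ⧸ Λ) = (γ z : Cn n ⧸ Λ)

/-- The orbifold fundamental group `Γ` of all lifts of elements of `G` to `ℂⁿ`. -/
noncomputable def lifts : Subgroup (Cn n ≃ₜ Cn n) where
  carrier := {γ | ∃ g : G, IsLift Λ g γ}
  one_mem' := ⟨1, fun z => by simp⟩
  mul_mem' := by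
    rintro a b ⟨g, hg⟩ ⟨h, hh⟩
    exact ⟨g * h, fun z => by rw [mul_smul, hh z, hg (b z)]; rfl⟩
  inv_mem' := by
    rintro a ⟨g, hg⟩
    refine ⟨g⁻¹, fun z => ?_⟩
    rw [inv_smul_eq_iff, hg (a⁻¹ z)]
    exact congrArg _ (a.apply_symm_apply z).symm

/-- `Γ_fix`: the subgroup of `Γ` generated by the elements with a fixed point on `ℂⁿ`. -/
noncomputable def liftsFix : Subgroup (Cn n ≃ₜ Cn n) :=
  Subgroup.closure {γ | γ ∈ lifts Λ G ∧ ∃ z, γ z = z}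

/-- `G_fix`: the subgroup of `G` generated by the elements with a fixed point on `T`. -/
def groupFix : Subgroup G :=
  Subgroup.closure {g | ∃ x : Cn n ⧸ Λ, g • x = x}

instance groupFix_normal : (groupFix Λ G).Normal := by
  have h : Group.conjugatesOfSet {g : G | ∃ x : Cn n ⧸ Λ, g • x = x}
      = {g : G | ∃ x : Cn n ⧸ Λ, g • x = x} := by
    refine Set.Subset.antisymm ?_ Group.subset_conjugatesOfSet
    intro c hc
    obtain ⟨a, ⟨x, hx⟩, hac⟩ := Group.mem_conjugatesOfSet_iff.1 hc
    obtain ⟨g, rfl⟩ := isConj_iff.1 hac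
    exact ⟨g • x, by simp [mul_smul, hx]⟩
  have h' : groupFix Λ G = Subgroup.normalClosure {g : G | ∃ x : Cn n ⧸ Λ, g • x = x} := by
    rw [groupFix, Subgroup.normalClosure, h]
  rw [h']
  infer_instance

theorem liftsFix_le : liftsFix Λ G ≤ lifts Λ G :=
  (Subgroup.closure_le _).2 fun _ h => h.1

/-- The lattice `Λ' = Λ ∩ Γ_fix` of those `v ∈ Λ` whose translation `z ↦ z + v` lies in
`Γ_fix`. -/
noncomputable def fixLattice : AddSubgroup (Cn n) where
  carrier := {v | v ∈ Λ ∧ Homeomorph.addRight v ∈ liftsFix Λ G}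
  zero_mem' := ⟨Λ.zero_mem, by
    convert! (liftsFix Λ G).one_mem
    ext1 z
    simp⟩
  add_mem' := by
    rintro a b ⟨ha, ha'⟩ ⟨hb, hb'⟩
    refine ⟨Λ.add_mem ha hb, ?_⟩
    convert! (liftsFix Λ G).mul_mem hb' ha' using 1
    ext1 z
    simp [add_assoc]
  neg_mem' := by
    rintro a ⟨ha, ha'⟩
    refine ⟨Λ.neg_mem ha, ?_⟩
    convert! (liftsFix Λ G).inv_mem ha' using 1
    exact Homeomorph.ext fun z => rfl

/-- `T' = ℂⁿ / Λ'`, a possibly non-compact torus. -/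
abbrev FixTorus : Type := Cn n ⧸ fixLattice Λ G

/-- `Λ'` viewed as a subgroup of `Γ_fix`: the translations `z ↦ z + v` with `v ∈ Λ'`. -/
noncomputable def fixTranslations : Subgroup (liftsFix Λ G) where
  carrier := {γ | ∃ v ∈ fixLattice Λ G, ∀ z, γ.1 z = z + v}
  one_mem' := ⟨0, (fixLattice Λ G).zero_mem, fun z => by simp⟩
  mul_mem' := by
    rintro a b ⟨v, hv, ha⟩ ⟨w, hw, hb⟩
    refine ⟨w + v, (fixLattice Λ G).add_mem hw hv, fun z => ?_⟩
    change a.1 (b.1 z) = _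
    rw [hb, ha, add_assoc]
  inv_mem' := by
    rintro a ⟨v, hv, ha⟩
    refine ⟨-v, (fixLattice Λ G).neg_mem hv, fun z => ?_⟩
    change a.1.symm z = _
    rw [Homeomorph.symm_apply_eq, ha]
    simp

/-- A homeomorphism lifting the identity of `T` is the translation by a vector of `Λ`. -/
theorem exists_translation [DiscreteTopology Λ] (δ : Cn n ≃ₜ Cn n)
    (h : ∀ z : Cn n, (δ z : Cn n ⧸ Λ) = z) : ∃ v ∈ Λ, ∀ z, δ z = z + v := by
  have hm : ∀ z, -z + δ z ∈ Λ := fun z => QuotientAddGroup.eq.1 (h z).symm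
  let f : Cn n → Λ := fun z => ⟨-z + δ z, hm z⟩
  have hf : Continuous f := by
    refine Continuous.subtype_mk ?_ _
    exact continuous_neg.add δ.continuous
  refine ⟨f 0, (f 0).2, fun z => ?_⟩
  have e : f z = f 0 := PreconnectedSpace.constant inferInstance hf
  rw [← e]
  simp [f]

instance fixTranslations_normal [DiscreteTopology Λ] : (fixTranslations Λ G).Normal where
  conj_mem := by
    rintro t ⟨v, hv, ht⟩ γ
    obtain ⟨g, hg⟩ := liftsFix_le Λ G γ.2
    obtain ⟨w, hw, h⟩ := exists_translation Λ (γ * t * γ⁻¹ : liftsFix Λ G).1 (fun z => by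
      change ((γ.1 (t.1 (γ.1.symm z)) : Cn n) : Cn n ⧸ Λ) = z
      rw [ht, ← hg]
      have e : ((γ.1.symm z + v : Cn n) : Cn n ⧸ Λ) = (γ.1.symm z : Cn n) := by
        rw [QuotientAddGroup.eq]
        simpa using hv.1
      rw [e, hg, Homeomorph.apply_symm_apply])
    refine ⟨w, ⟨hw, ?_⟩, h⟩
    convert! (γ * t * γ⁻¹ : liftsFix Λ G).2
    ext1 z
    exact (h z).symm

/-- The action of `Γ_fix / Λ'` on `T' = ℂⁿ / Λ'` induced by the action of `Γ_fix` on `ℂⁿ`: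
`[γ] • [z] = [γ z]`. -/
noncomputable instance fixTorusAction [DiscreteTopology Λ] :
    MulAction (liftsFix Λ G ⧸ fixTranslations Λ G) (FixTorus Λ G) where
  smul := Quotient.map₂ (fun γ z => γ.1 z) (by
    intro γ γ' hγ z z' hz
    have hγ' : γ⁻¹ * γ' ∈ fixTranslations Λ G := QuotientGroup.leftRel_apply.1 hγ
    have hz' : -z + z' ∈ fixLattice Λ G := QuotientAddGroup.leftRel_apply.1 hz
    obtain ⟨u, hu, h⟩ := hγ'
    have h1 : γ'.1 z' = γ.1 (z' + u) := by
      rw [← h]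
      exact (γ.1.apply_symm_apply (γ'.1 z')).symm
    let t : liftsFix Λ G :=
      ⟨Homeomorph.addRight (-z + z' + u), ((fixLattice Λ G).add_mem hz' hu).2⟩
    have ht : t ∈ fixTranslations Λ G :=
      ⟨-z + z' + u, (fixLattice Λ G).add_mem hz' hu, fun _ => rfl⟩
    obtain ⟨w, hw, h2⟩ := (fixTranslations_normal Λ G).conj_mem t ht γ
    have h3 : γ.1 (z' + u) = γ.1 z + w := by
      rw [← h2]
      change _ = γ.1 (γ.1.symm (γ.1 z) + (-z + z' + u))
      rw [Homeomorph.symm_apply_apply]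
      congr 1
      abel
    apply QuotientAddGroup.leftRel_apply.2
    rw [h1, h3]
    simpa using hw)
  one_smul x := by
    induction x using QuotientAddGroup.induction_on with
    | _ z => rfl
  mul_smul a b x := by
    induction a using QuotientGroup.induction_on with
    | _ a =>
      induction b using QuotientGroup.induction_on with
      | _ b =>
        induction x using QuotientAddGroup.induction_on with
        | _ z => rfl

theorem fixTorusAction_mk [DiscreteTopology Λ] (γ : liftsFix Λ G) (z : Cn n) :
    (γ : liftsFix Λ G ⧸ fixTranslations Λ G) • (z : FixTorus Λ G) = (γ.1 z : Cn n) := rfl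

/-- The natural map `ℂⁿ / Γ_fix → T / G`, `[z] ↦ [p z]`. -/
noncomputable def coverMap : OrbitSpace (liftsFix Λ G) (Cn n) → OrbitSpace G (Cn n ⧸ Λ) :=
  Quotient.lift (fun z => orbitMk G (z : Cn n ⧸ Λ)) (by
    rintro a b ⟨γ, rfl⟩
    obtain ⟨g, hg⟩ := liftsFix_le Λ G γ.2
    exact Quotient.sound ⟨g, hg b⟩)

end

end TorusQuotient

/-! Each `g` lifts to `ℂⁿ`, and its lifts differ by `Λ`. A lift is holomorphic and commutes with `Λ`
up to `Λ`, so Liouville makes it affine, with linear part depending only on `g`. Since `G` is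
finite, `Γ` has locally finite orbits and a uniform Lipschitz bound. Hence each `x` has a slice: a
ball such that every `γ` moving a point of it into it fixes `x` (`exists_slice_lifts`).

Slices drive the topology. An element returning to a slice lies in `Γ_fix`, so `Γ / Γ_fix` acts on
`ℂⁿ / Γ_fix` as the deck group of a covering of `T / G` (`isQuotientCoveringMap_coverMap`). The
image of a slice is contractible, so a loop in `ℂⁿ / Γ_fix` is homotopic to the image of a path from
some `x` to some `γ x`. As `γ` is a product of elements with fixed points, that image is
null-homotopic (`simplyConnectedSpace_orbitSpace`).

If `g` fixes `p z`, some lift of `g` fixes `z`. Thus `Γ_fix` maps onto `G_fix` with kernel `Λ'`, and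
if `Λ ⊂ Γ_fix` then `Γ_fix` is the full preimage of `G_fix`, so the deck group is `G / G_fix`. For
compactness, finiteness of `Γ_fix / Λ'` relates the orbit space to `T'`, and averaging the norm over
`G` turns `Γ_fix` into a group of Euclidean motions. -/

namespace TorusQuotient

open scoped unitInterval

/-! ### Lifting paths up to homotopy -/

section LocalLifting

variable {X Y : Type*} [TopologicalSpace X] [TopologicalSpace Y]

/-- `p` is homotopic to the image under `q` of a path starting at any given point over the
starting point of `p`. -/
def LiftsUpToHomotopy (q : C(X, Y)) {y y' : Y} (p : Path y y') : Prop :=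
  ∀ a : X, ∀ ha : y = q a, ∃ (b : X) (hb : y' = q b) (c : Path a b),
    p.Homotopic ((c.map q.continuous).cast ha hb)

theorem LiftsUpToHomotopy.of_homotopic {q : C(X, Y)} {y y' : Y} {p p' : Path y y'}
    (h : LiftsUpToHomotopy q p) (hp : p'.Homotopic p) : LiftsUpToHomotopy q p' := by
  intro a ha
  obtain ⟨b, hb, c, hc⟩ := h a ha
  exact ⟨b, hb, c, hp.trans hc⟩

theorem LiftsUpToHomotopy.trans {q : C(X, Y)} {y y' y'' : Y} {p : Path y y'} {p' : Path y' y''}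
    (h : LiftsUpToHomotopy q p) (h' : LiftsUpToHomotopy q p') :
    LiftsUpToHomotopy q (p.trans p') := by
  intro a ha
  obtain ⟨b, hb, c, hc⟩ := h a ha
  obtain ⟨b', hb', c', hc'⟩ := h' b hb
  subst ha hb hb'
  refine ⟨b', rfl, c.trans c', ?_⟩
  have := hc.hcomp hc'
  simpa [Path.map_trans] using this

theorem liftsUpToHomotopy_refl (q : C(X, Y)) (y : Y) : LiftsUpToHomotopy q (Path.refl y) := by
  intro a ha
  subst ha
  exact ⟨a, rfl, Path.refl a, Path.Homotopic.refl _⟩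

/-- If every point of `Y` has a neighbourhood in which paths lift up to homotopy, then all paths
lift up to homotopy. -/
theorem liftsUpToHomotopy_of_locally {q : C(X, Y)}
    (hloc : ∀ y : Y, ∃ V : Set Y, IsOpen V ∧ y ∈ V ∧
      ∀ (y₁ y₂ : Y) (p : Path y₁ y₂), (∀ t, p t ∈ V) → LiftsUpToHomotopy q p)
    {y y' : Y} (p : Path y y') : LiftsUpToHomotopy q p := by
  choose V hVo hV hVl using hloc
  obtain ⟨t, t0, tmono, ⟨m, hm⟩, ht⟩ := exists_monotone_Icc_subset_open_cover_unitInterval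
    (fun y => (hVo y).preimage p.continuous) fun s _ => Set.mem_iUnion.2 ⟨p s, hV _⟩
  -- Induction along a Lebesgue subdivision: each subinterval maps into a single good neighbourhood.
  have key : ∀ k, LiftsUpToHomotopy q (p.subpath 0 (t k)) := by
    intro k
    induction k with
    | zero =>
      rw [t0, Path.subpath_self]
      exact liftsUpToHomotopy_refl _ _
    | succ k ih =>
      obtain ⟨z, hz⟩ := ht k
      have h1 : LiftsUpToHomotopy q (p.subpath (t k) (t (k + 1))) := by
        refine hVl z _ _ _ fun s => ?_
        have hs : p.subpath (t k) (t (k + 1)) s ∈ Set.range (p.subpath (t k) (t (k + 1))) := ⟨s, rfl⟩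
        rw [Path.range_subpath_of_le _ _ _ (tmono k.le_succ)] at hs
        obtain ⟨r, hr, hrs⟩ := hs
        rw [← hrs]
        exact hz hr
      exact (ih.trans h1).of_homotopic ⟨(Path.Homotopy.subpathTransSubpath p _ _ _).symm⟩
  have h := key m
  rw [hm m le_rfl, Path.subpath_zero_one] at h
  intro a ha
  obtain ⟨b, hb, c, hc⟩ := h a (p.source.trans ha)
  exact ⟨b, p.target.symm.trans hb, c, hc.pathCast p.source.symm p.target.symm⟩

/-- Paths in a simply connected neighbourhood lift up to homotopy if the points of the
neighbourhood are joined by images of paths inside the neighbourhood. -/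
theorem liftsUpToHomotopy_of_simplyConnected {q : C(X, Y)} {V : Set Y} [SimplyConnectedSpace V]
    (hV : ∀ a : X, q a ∈ V → ∀ y ∈ V, ∃ (b : X) (_ : q b = y) (c : Path a b), ∀ t, q (c t) ∈ V)
    {y y' : Y} (p : Path y y') (hp : ∀ t, p t ∈ V) : LiftsUpToHomotopy q p := by
  intro a ha
  have hyV : y ∈ V := by simpa using hp 0
  have hyV' : y' ∈ V := by simpa using hp 1
  obtain ⟨b, hb, c, hc⟩ := hV a (ha ▸ hyV) y' hyV'
  refine ⟨b, hb.symm, c, ?_⟩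
  let p₁ : Path (⟨y, hyV⟩ : V) ⟨y', hyV'⟩ :=
    { toFun t := ⟨p t, hp t⟩
      source' := by simp
      target' := by simp }
  let p₂ : Path (⟨y, hyV⟩ : V) ⟨y', hyV'⟩ :=
    { toFun t := ⟨q (c t), hc t⟩
      source' := by simp [ha]
      target' := by simp [hb] }
  exact (SimplyConnectedSpace.paths_homotopic p₁ p₂).map ⟨Subtype.val, continuous_subtype_val⟩

end LocalLifting

/-! ### Groups generated by elements with fixed points -/

section Generation

variable {X : Type*} [TopologicalSpace X] {N : Type*} [Group N] [MulAction N X]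

/-- The orbit map as a continuous map. -/
def orbitMap (N X : Type*) [TopologicalSpace X] [Group N] [MulAction N X] :
    C(X, OrbitSpace N X) := ⟨orbitMk N, continuous_quotient_mk'⟩

theorem orbitMap_smul (g : N) (x : X) : orbitMap N X (g • x) = orbitMap N X x :=
  Quotient.sound ⟨g, rfl⟩

theorem orbitMk_eq_iff {X N : Type*} [Group N] [MulAction N X] {x y : X} : orbitMk N x = orbitMk N y ↔ ∃ g : N, g • y = x :=
  Quotient.eq''

/-- If `g` fixes `z`, go from `x` to `z` and return along the `g`-translate of the same path: in the
quotient this is a path followed by its reverse. Products and inverses of such elements correspond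
to concatenation and reversal. -/
theorem homotopic_refl_of_closure_fixed [SimplyConnectedSpace X] [ContinuousConstSMul N X]
    (hN : Subgroup.closure {g : N | ∃ x : X, g • x = x} = ⊤) (g : N) {x y : X} (hy : y = g • x)
    (c : Path x y) (h : orbitMap N X x = orbitMap N X y) :
    ((c.map (orbitMap N X).continuous).cast rfl h).Homotopic (Path.refl _) := by
  have hg : g ∈ Subgroup.closure {g : N | ∃ x : X, g • x = x} := hN ▸ Subgroup.mem_top g
  -- Since `X` is simply connected, any convenient path with the given ends may replace `c`.
  have indep : ∀ {x y : X} (c c' : Path x y) (h : orbitMap N X x = orbitMap N X y),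
      ((c'.map (orbitMap N X).continuous).cast rfl h).Homotopic (Path.refl _) →
      ((c.map (orbitMap N X).continuous).cast rfl h).Homotopic (Path.refl _) := by
    intro x y c c' h hc
    refine Path.Homotopic.trans ?_ hc
    exact ((SimplyConnectedSpace.paths_homotopic c c').map (orbitMap N X)).pathCast rfl h
  have mapsmul : ∀ (g : N) {x y : X} (c : Path x y) (t : I),
      orbitMap N X (c.map (continuous_const_smul g) t) = orbitMap N X (c t) :=
    fun g _ _ c t => orbitMap_smul g (c t)
  induction hg using Subgroup.closure_induction generalizing x y with
  | mem g hg =>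
    obtain ⟨z, hz⟩ := hg
    subst hy
    let c₀ : Path x z := PathConnectedSpace.somePath x z
    let c₁ : Path z (g • x) := (c₀.map (continuous_const_smul g)).symm.cast hz.symm rfl
    refine indep _ (c₀.trans c₁) h ?_
    have e : ((c₀.trans c₁).map (orbitMap N X).continuous).cast rfl h
        = (c₀.map (orbitMap N X).continuous).trans (c₀.map (orbitMap N X).continuous).symm := by
      ext t
      simp only [Path.cast_coe, Path.map_coe, Function.comp, Path.trans_apply]
      split_ifs
      · rfl
      · exact mapsmul g c₀ _
    rw [e]
    exact ⟨(Path.Homotopy.reflTransSymm _).symm⟩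
  | one =>
    have : y = x := by simpa using hy
    subst this
    exact indep _ (Path.refl _) h (Path.Homotopic.refl _)
  | mul a b _ _ ha hb =>
    subst hy
    let c₀ : Path x (b • x) := PathConnectedSpace.somePath _ _
    let c₁ : Path (b • x) ((a * b) • x) := PathConnectedSpace.somePath _ _
    have h0 : orbitMap N X x = orbitMap N X (b • x) := (orbitMap_smul _ _).symm
    refine indep _ (c₀.trans c₁) h ?_
    have h1 := hb rfl c₀ h0
    have h2 := ha (mul_smul _ _ _) c₁ (h0.symm.trans h)
    have h3 := h1.hcomp ((h2.pathCast h0 h0))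
    have e : (Path.refl (orbitMap N X (b • x))).cast h0 h0 = Path.refl (orbitMap N X x) :=
      Path.ext (funext fun _ => h0.symm)
    rw [e] at h3
    have e' : ((c₀.trans c₁).map (orbitMap N X).continuous).cast rfl h
        = ((c₀.map (orbitMap N X).continuous).cast rfl h0).trans
          (((c₁.map (orbitMap N X).continuous).cast rfl (h0.symm.trans h)).cast h0 h0) := by
      ext t
      simp only [Path.cast_coe, Path.map_coe, Function.comp, Path.trans_apply]
      split_ifs <;> rfl
    rw [e']
    exact h3.trans ⟨Path.Homotopy.transRefl _⟩
  | inv a _ ha =>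
    have hx : x = a • y := by rw [hy, smul_inv_smul]
    have h1 := (ha hx c.symm h.symm).symm₂
    have h2 := h1.pathCast h h
    convert! h2 using 1
    · ext t
      simp
    · exact Path.ext (funext fun _ => h)

end Generation

/-! ### Slices of affine actions -/

section Radial

variable {E : Type*} [NormedAddCommGroup E] [NormedSpace ℝ E]
  {N : Type*} [Group N] [MulAction N E]

/-- A point `x` is isolated from its translates: elements which move some point of the ball of
radius `ε` about `x` into this ball fix `x`. -/
def IsSlice (N : Type*) [Group N] [MulAction N E] (x : E) (ε : ℝ) : Prop :=
  0 < ε ∧ ∀ g : N, ∀ w ∈ Metric.ball x ε, g • w ∈ Metric.ball x ε → g • x = x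

theorem radial_mem_ball {x w : E} {ε : ℝ} (hw : w ∈ Metric.ball x ε) (t : I) :
    x + (1 - t : ℝ) • (w - x) ∈ Metric.ball x ε := by
  rw [Metric.mem_ball, dist_eq_norm] at hw ⊢
  rw [add_sub_cancel_left, norm_smul]
  have h1 : ‖(1 - t : ℝ)‖ ≤ 1 := by
    rw [Real.norm_eq_abs, abs_of_nonneg (by linarith [t.2.2])]
    linarith [t.2.1]
  exact (mul_le_of_le_one_left (norm_nonneg _) h1).trans_lt hw

theorem smul_radial (haff : ∀ (g : N) (x v : E) (t : ℝ), g • (x + t • v) - g • x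
    = t • (g • (x + v) - g • x)) {g : N} {x : E} (hx : g • x = x) (w : E) (t : ℝ) :
    g • (x + t • (w - x)) = x + t • (g • w - x) := by
  have := haff g x (w - x) t
  rw [hx, add_sub_cancel, sub_eq_iff_eq_add'] at this
  exact this

/-- Radial contraction to `x` commutes with affine maps fixing `x`, and in a slice only such maps
identify points of the ball. So the contraction descends. -/
theorem contractibleSpace_image_ball [ContinuousConstSMul N E]
    (haff : ∀ (g : N) (x v : E) (t : ℝ), g • (x + t • v) - g • x = t • (g • (x + v) - g • x))
    {x : E} {ε : ℝ} (hx : IsSlice N x ε) :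
    ContractibleSpace (orbitMap N E '' Metric.ball x ε) := by
  set B := Metric.ball x ε with hB
  set V := orbitMap N E '' B with hV
  have hxB : x ∈ B := Metric.mem_ball_self hx.1
  let r : C(B, V) := ⟨fun w => ⟨orbitMap N E w, w, w.2, rfl⟩, by fun_prop⟩
  have hopen : IsOpenMap (orbitMap N E) := MulAction.isOpenQuotientMap_quotientMk.isOpenMap
  have hr : IsOpenQuotientMap r := by
    refine ⟨?_, r.continuous, ?_⟩
    · rintro ⟨_, w, hw, rfl⟩
      exact ⟨⟨w, hw⟩, rfl⟩
    · have h1 : IsOpenMap (fun w : B => orbitMap N E w) :=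
        hopen.comp Metric.isOpen_ball.isOpenMap_subtype_val
      exact h1.subtype_mk _
  let f : C(I × B, V) := ⟨fun tw => ⟨orbitMap N E (x + (1 - tw.1 : ℝ) • ((tw.2 : E) - x)), _,
    radial_mem_ball tw.2.2 tw.1, rfl⟩, by fun_prop⟩
  -- Openness of `r` is what keeps its product with the interval a quotient map.
  have hq : IsQuotientMap ((ContinuousMap.id I).prodMap r) :=
    (IsOpenQuotientMap.id.prodMap hr).isQuotientMap
  have hf : Function.FactorsThrough f ((ContinuousMap.id I).prodMap r) := by
    rintro ⟨t, w⟩ ⟨t', w'⟩ h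
    obtain ⟨h1, h2⟩ := Prod.ext_iff.1 h
    change t = t' at h1
    subst h1
    have h3 : orbitMk N (w : E) = orbitMk N (w' : E) := congrArg Subtype.val h2
    obtain ⟨g, hg⟩ := orbitMk_eq_iff.1 h3
    have hgx := hx.2 g w' w'.2 (hg ▸ w.2)
    refine Subtype.ext ?_
    change orbitMap N E (x + (1 - t : ℝ) • ((w : E) - x))
      = orbitMap N E (x + (1 - t : ℝ) • ((w' : E) - x))
    rw [← hg, ← smul_radial haff hgx, orbitMap_smul]
  let F : C(I × V, V) := hq.lift f hf
  have hF : ∀ (t : I) (w : B), F (t, r w) = f (t, w) := fun t w =>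
    congrFun (congrArg DFunLike.coe (hq.lift_comp f hf)) (t, w)
  rw [contractible_iff_id_nullhomotopic]
  refine ⟨r ⟨x, hxB⟩, ⟨⟨F, fun v => ?_, fun v => ?_⟩⟩⟩
  · obtain ⟨w, rfl⟩ := hr.surjective v
    refine (hF 0 w).trans (Subtype.ext ?_)
    simp [f, r]
  · obtain ⟨w, rfl⟩ := hr.surjective v
    refine (hF 1 w).trans (Subtype.ext ?_)
    simp [f, r]

/-- The point `a` may lie outside the ball; it is `g • w` with `w` inside, so a path in the ball
starting at `w` is moved by `g`. -/
theorem joined_in_image_ball [ContinuousConstSMul N E] {x : E} {ε : ℝ} (a : E)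
    (ha : orbitMap N E a ∈ orbitMap N E '' Metric.ball x ε) (y : OrbitSpace N E)
    (hy : y ∈ orbitMap N E '' Metric.ball x ε) :
    ∃ (b : E) (_ : orbitMap N E b = y) (c : Path a b),
      ∀ t, orbitMap N E (c t) ∈ orbitMap N E '' Metric.ball x ε := by
  obtain ⟨w, hw, hwa⟩ := ha
  obtain ⟨v, hv, rfl⟩ := hy
  obtain ⟨g, hg⟩ := orbitMk_eq_iff.1 hwa.symm
  obtain ⟨c, hc⟩ := ((convex_ball x ε).isPathConnected ⟨w, hw⟩).joinedIn w hw v hv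
  refine ⟨g • v, orbitMap_smul _ _,
    (c.map (continuous_const_smul g)).cast hg.symm rfl, fun t => ⟨c t, hc t, ?_⟩⟩
  exact (orbitMap_smul g (c t)).symm

/-- If a group acts on a real normed space by affine homeomorphisms, such that every point has a
slice, and is generated by its elements with fixed points, then the orbit space is simply
connected. -/
theorem simplyConnectedSpace_orbitSpace [ContinuousConstSMul N E]
    (haff : ∀ (g : N) (x v : E) (t : ℝ), g • (x + t • v) - g • x = t • (g • (x + v) - g • x))
    (hslice : ∀ x : E, ∃ ε, IsSlice N x ε)
    (hN : Subgroup.closure {g : N | ∃ x : E, g • x = x} = ⊤) :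
    SimplyConnectedSpace (OrbitSpace N E) := by
  have hlift : ∀ {y y' : OrbitSpace N E} (p : Path y y'), LiftsUpToHomotopy (orbitMap N E) p := by
    intro y y' p
    refine liftsUpToHomotopy_of_locally (fun y => ?_) p
    obtain ⟨x, rfl⟩ := Quotient.exists_rep y
    obtain ⟨ε, hε⟩ := hslice x
    have := contractibleSpace_image_ball haff hε
    have hopen : IsOpenMap (orbitMap N E) := MulAction.isOpenQuotientMap_quotientMk.isOpenMap
    exact ⟨_, hopen _ Metric.isOpen_ball, ⟨x, Metric.mem_ball_self hε.1, rfl⟩, fun _ _ p hp =>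
      liftsUpToHomotopy_of_simplyConnected joined_in_image_ball p hp⟩
  rw [simply_connected_iff_loops_nullhomotopic]
  refine ⟨inferInstance, fun y p => ?_⟩
  obtain ⟨x, rfl⟩ := Quotient.exists_rep y
  obtain ⟨b, hb, c, hc⟩ := hlift p x rfl
  obtain ⟨g, hg⟩ := orbitMk_eq_iff.1 hb.symm
  exact hc.trans (homotopic_refl_of_closure_fixed hN g hg.symm c hb)

end Radial

/-! ### Lifts to `ℂⁿ`: existence, affineness, local finiteness -/

section Lifts

variable {n : ℕ} (Λ : AddSubgroup (Cn n)) [DiscreteTopology Λ]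

theorem isCoveringMap_mk : IsCoveringMap (QuotientAddGroup.mk : Cn n → Cn n ⧸ Λ) :=
  (AddSubgroup.isAddQuotientCoveringMap_of_comm Λ DiscreteTopology.isDiscrete).isCoveringMap

omit [DiscreteTopology Λ] in
variable {Λ} in
theorem mk_add_of_mem (z : Cn n) {v : Cn n} (hv : v ∈ Λ) :
    ((z + v : Cn n) : Cn n ⧸ Λ) = z := by
  rw [QuotientAddGroup.eq]
  simpa using hv

variable {Λ} in
/-- Two continuous maps into `ℂⁿ` which agree modulo `Λ` differ by a constant. -/
theorem exists_eq_add_of_mk_eq {X : Type*} [TopologicalSpace X] {s : Set X}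
    (hs : IsPreconnected s) {f g : X → Cn n} (hf : ContinuousOn f s) (hg : ContinuousOn g s)
    (h : ∀ z ∈ s, (f z : Cn n ⧸ Λ) = g z) : ∃ v ∈ Λ, ∀ z ∈ s, f z = g z + v := by
  rcases s.eq_empty_or_nonempty with rfl | ⟨a, ha⟩
  · exact ⟨0, Λ.zero_mem, fun z hz => hz.elim⟩
  have hm : ∀ z ∈ s, -g z + f z ∈ (Λ : Set (Cn n)) := fun z hz =>
    QuotientAddGroup.eq.1 (h z hz).symm
  have hc : ContinuousOn (fun z => -g z + f z) s := hg.neg.add hf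
  refine ⟨-g a + f a, hm a ha, fun z hz => ?_⟩
  have e : -g z + f z = -g a + f a :=
    hs.constant_of_mapsTo DiscreteTopology.isDiscrete hc hm hz ha
  rw [← e]
  abel

/-- A continuous function on `ℂⁿ` which is periodic with respect to a lattice has bounded range. -/
theorem isBounded_range_of_periodic (hΛ : Submodule.span ℝ (Λ : Set (Cn n)) = ⊤)
    {f : Cn n → Cn n} (hf : Continuous f) (hp : ∀ z, ∀ v ∈ Λ, f (z + v) = f z) :
    Bornology.IsBounded (Set.range f) := by
  let L : Submodule ℤ (Cn n) := AddSubgroup.toIntSubmodule Λ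
  have : DiscreteTopology L := inferInstanceAs (DiscreteTopology Λ)
  have : IsZLattice ℝ L := ⟨hΛ⟩
  exact (IsZLattice.isCompact_range_of_periodic L f hf hp).isBounded

omit [DiscreteTopology Λ] in
theorem IsHolomorphicMap.continuous {f : Cn n ⧸ Λ → Cn n ⧸ Λ} (hf : IsHolomorphicMap Λ f) :
    Continuous f := by
  have hq : IsQuotientMap (QuotientAddGroup.mk : Cn n → Cn n ⧸ Λ) := isQuotientMap_quotient_mk'
  rw [hq.continuous_iff, continuous_iff_continuousAt]
  intro z
  obtain ⟨U, hU, F, hF, h⟩ := hf z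
  have h1 : ContinuousAt (fun w => (F w : Cn n ⧸ Λ)) z :=
    hq.continuous.continuousAt.comp (hF.differentiableAt hU).continuousAt
  exact h1.congr (Filter.eventually_of_mem hU fun w hw => (h w hw).symm)

/-- A continuous lift of a holomorphic map between complex tori is holomorphic. -/
theorem IsHolomorphicMap.differentiable_lift {f : Cn n ⧸ Λ → Cn n ⧸ Λ}
    (hf : IsHolomorphicMap Λ f) {F : Cn n → Cn n} (hF : Continuous F)
    (h : ∀ z : Cn n, f z = F z) : Differentiable ℂ F := by
  intro z
  obtain ⟨U, hU, F', hF', h'⟩ := hf z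
  obtain ⟨ε, hε, hεU⟩ := Metric.mem_nhds_iff.1 hU
  obtain ⟨v, -, hv⟩ := exists_eq_add_of_mk_eq (Λ := Λ) (convex_ball z ε).isPreconnected
    hF.continuousOn (hF'.continuousOn.mono hεU) (fun w hw => by rw [← h w, h' w (hεU hw)])
  have h1 : DifferentiableAt ℂ (fun w => F' w + v) z := (hF'.differentiableAt hU).add_const v
  exact h1.congr_of_eventuallyEq (Filter.eventually_of_mem (Metric.ball_mem_nhds z hε) hv)

/-- A holomorphic map of `ℂⁿ` which commutes with lattice translations up to lattice translations
is affine. -/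
theorem exists_affine_of_differentiable (hΛ : Submodule.span ℝ (Λ : Set (Cn n)) = ⊤)
    {F : Cn n → Cn n} (hF : Differentiable ℂ F)
    (h : ∀ z, ∀ v ∈ Λ, (F (z + v) : Cn n ⧸ Λ) = F z) :
    ∃ L : Cn n →L[ℂ] Cn n, ∀ z, F z = L z + F 0 := by
  -- Translation by a lattice vector changes `F` by a constant, so `z ↦ F (z + v) - F z` is
  -- periodic, hence bounded, hence constant by Liouville.
  have hadd : ∀ z v, F (z + v) - F z = F v - F 0 := by
    intro z v
    have hd : Differentiable ℂ fun z => F (z + v) - F z :=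
      (hF.comp (differentiable_id.add_const v)).sub hF
    have hb := isBounded_range_of_periodic Λ hΛ hd.continuous (fun z w hw => by
      obtain ⟨u, -, hu⟩ := exists_eq_add_of_mk_eq (Λ := Λ) (s := Set.univ) isPreconnected_univ
        (hF.continuous.comp (continuous_add_const w)).continuousOn hF.continuous.continuousOn
        (fun z _ => h z w hw)
      have h1 := hu (z + v) trivial
      have h2 := hu z trivial
      simp only [Function.comp] at h1 h2
      rw [add_right_comm, h1, h2]
      abel)
    simpa using hd.apply_eq_apply_of_bounded hb z 0
  -- Continuous and additive gives real linear; comparison with the complex derivative at `0` then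
  -- gives complex linear.
  let a : Cn n →+ Cn n :=
    { toFun z := F z - F 0
      map_zero' := sub_self _
      map_add' z w := by rw [← hadd z w]; abel }
  have ha : Continuous a := hF.continuous.sub continuous_const
  let A : Cn n →L[ℝ] Cn n := a.toRealLinearMap ha
  have hA : HasFDerivAt (𝕜 := ℝ) F A 0 := by
    have h1 : HasFDerivAt (fun z => A z + F 0) A 0 := A.hasFDerivAt.add_const _
    convert! h1 using 1
    ext1 z
    exact (sub_add_cancel (F z) (F 0)).symm
  have hD := ((hF 0).hasFDerivAt.restrictScalars ℝ).unique hA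
  refine ⟨fderiv ℂ F 0, fun z => ?_⟩
  have h1 := congrArg (fun B : Cn n →L[ℝ] Cn n => B z) hD
  rw [show fderiv ℂ F 0 z = F z - F 0 from h1, sub_add_cancel]

variable {Λ} {G : Type*} [Group G] [MulAction G (Cn n ⧸ Λ)]

omit [DiscreteTopology Λ] in
theorem IsLift.mul {g h : G} {γ δ : Cn n ≃ₜ Cn n} (hg : IsLift Λ g γ) (hh : IsLift Λ h δ) :
    IsLift Λ (g * h) (γ * δ) := fun z => by rw [mul_smul, hh z, hg (δ z)]; rfl

omit [DiscreteTopology Λ] in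
theorem IsLift.inv {g : G} {γ : Cn n ≃ₜ Cn n} (hg : IsLift Λ g γ) : IsLift Λ g⁻¹ γ⁻¹ := fun z => by
  rw [inv_smul_eq_iff, hg (γ⁻¹ z)]
  exact congrArg _ (γ.apply_symm_apply z).symm

omit [DiscreteTopology Λ] in
theorem isLift_one : IsLift Λ (1 : G) 1 := fun z => by simp

omit [DiscreteTopology Λ] in
theorem isLift_addRight {v : Cn n} (hv : v ∈ Λ) : IsLift Λ (1 : G) (Homeomorph.addRight v) :=
  fun z => by
    rw [one_smul]
    exact (mk_add_of_mem z hv).symm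

/-- Two lifts of the same element differ by a translation. -/
theorem IsLift.exists_eq_add {g : G} {γ δ : Cn n ≃ₜ Cn n} (hγ : IsLift Λ g γ)
    (hδ : IsLift Λ g δ) : ∃ v ∈ Λ, ∀ z, γ z = δ z + v := by
  obtain ⟨v, hv, h⟩ := exists_eq_add_of_mk_eq (Λ := Λ) (s := Set.univ) isPreconnected_univ
    γ.continuous.continuousOn δ.continuous.continuousOn (fun z _ => by rw [← hγ z, ← hδ z])
  exact ⟨v, hv, fun z => h z trivial⟩

/-- Every element of `G` lifts to `ℂⁿ`. -/
theorem exists_isLift (hc : ∀ g : G, Continuous fun x : Cn n ⧸ Λ => g • x) (g : G) :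
    ∃ γ : Cn n ≃ₜ Cn n, IsLift Λ g γ := by
  have hq : Continuous (QuotientAddGroup.mk : Cn n → Cn n ⧸ Λ) := continuous_quotient_mk'
  have key : ∀ g : G, ∃ F : C(Cn n, Cn n), ∀ z : Cn n, g • (z : Cn n ⧸ Λ) = F z := by
    intro g
    obtain ⟨w, hw⟩ := QuotientAddGroup.mk_surjective (g • ((0 : Cn n) : Cn n ⧸ Λ))
    obtain ⟨F, ⟨-, hF⟩, -⟩ := (isCoveringMap_mk Λ).existsUnique_continuousMap_lifts
      ⟨fun z : Cn n => g • (z : Cn n ⧸ Λ), (hc g).comp hq⟩ 0 w hw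
    exact ⟨F, fun z => (congrFun hF z).symm⟩
  have comp : ∀ (g : G) (F F' : C(Cn n, Cn n)), (∀ z : Cn n, g • (z : Cn n ⧸ Λ) = F z) →
      (∀ z : Cn n, g⁻¹ • (z : Cn n ⧸ Λ) = F' z) → ∃ v ∈ Λ, ∀ z, F (F' z) = z + v := by
    intro g F F' hF hF'
    obtain ⟨v, hv, h⟩ := exists_eq_add_of_mk_eq (Λ := Λ) (s := Set.univ) isPreconnected_univ
      (F.continuous.comp F'.continuous).continuousOn continuousOn_id (fun z _ => by
        simp only [Function.comp, id]
        rw [← hF, ← hF', smul_inv_smul])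
    exact ⟨v, hv, fun z => h z trivial⟩
  obtain ⟨F, hF⟩ := key g
  obtain ⟨F', hF'⟩ := key g⁻¹
  obtain ⟨v, hv, h⟩ := comp g F F' hF hF'
  obtain ⟨u, hu, h'⟩ := comp g⁻¹ F' F hF' (by simpa using hF)
  have hinj : Function.Injective F := fun x y hxy => by
    have := congrArg F' hxy
    rwa [h', h', add_left_inj] at this
  -- `F ∘ F'` is translation by `v`, whence the shift by `-v` in the inverse.
  exact ⟨{ toFun := F
           invFun := fun z => F' (z - v)
           left_inv := fun z => hinj (by rw [h, sub_add_cancel])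
           right_inv := fun z => by rw [h, sub_add_cancel]
           continuous_toFun := F.continuous
           continuous_invFun := F'.continuous.comp (continuous_sub_right v) }, hF⟩

variable (hΛ : Submodule.span ℝ (Λ : Set (Cn n)) = ⊤)
  (hol : ∀ g : G, IsHolomorphicMap Λ (fun x => g • x))

include hΛ hol in
/-- Lifts are affine. -/
theorem IsLift.exists_affine {g : G} {γ : Cn n ≃ₜ Cn n} (hγ : IsLift Λ g γ) :
    ∃ L : Cn n →L[ℂ] Cn n, ∀ z, γ z = L z + γ 0 :=
  exists_affine_of_differentiable Λ hΛ ((hol g).differentiable_lift Λ γ.continuous hγ)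
    fun z v hv => by rw [← hγ, ← hγ, mk_add_of_mem z hv]

include hΛ hol in
/-- The linear parts of the lifts define a representation of `G`. -/
theorem exists_linearPart : ∃ ρ : G → (Cn n →L[ℂ] Cn n),
    (∀ g γ, IsLift Λ g γ → ∀ z, γ z = ρ g z + γ 0) ∧
    (∀ v, ρ 1 v = v) ∧ ∀ g h v, ρ (g * h) v = ρ g (ρ h v) := by
  choose γ hγ using exists_isLift (fun g : G => (hol g).continuous)
  choose ρ hρ using fun g => (hγ g).exists_affine hΛ hol
  have key : ∀ g δ, IsLift Λ g δ → ∀ z, δ z = ρ g z + δ 0 := by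
    intro g δ hδ z
    obtain ⟨v, -, h⟩ := hδ.exists_eq_add (hγ g)
    rw [h z, h 0, hρ g z]
    abel
  refine ⟨ρ, key, fun v => ?_, fun g h v => ?_⟩
  · simpa using (key 1 1 isLift_one v).symm
  · have h1 := key _ _ ((hγ g).mul (hγ h)) v
    change γ g (γ h v) = _ + γ g (γ h 0) at h1
    rw [key g _ (hγ g) (γ h v), key g _ (hγ g) (γ h 0), key h _ (hγ h) v, map_add] at h1
    rw [← add_assoc] at h1
    exact (add_right_cancel (add_right_cancel h1)).symm

variable [Finite G]

/-- The orbits of the group of lifts are locally finite, with finite stabilizers. -/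
theorem finite_lifts (hc : ∀ g : G, Continuous fun x : Cn n ⧸ Λ => g • x) (z : Cn n) (R : ℝ) :
    {γ : Cn n ≃ₜ Cn n | γ ∈ lifts Λ G ∧ ‖γ z‖ ≤ R}.Finite := by
  choose γ hγ using exists_isLift hc
  have hfin : ∀ r : ℝ, (Metric.closedBall 0 r ∩ (Λ : Set (Cn n))).Finite := fun r =>
    Metric.finite_isBounded_inter_isClosed DiscreteTopology.isDiscrete Metric.isBounded_closedBall
      AddSubgroup.isClosed_of_discrete
  -- Every lift of `g` is `γ g` followed by a lattice translation `v`; the bound on the image of `z`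
  -- bounds `v`.
  refine (Set.finite_iUnion fun g : G => (hfin (R + ‖γ g z‖)).image
    fun v => (γ g).trans (Homeomorph.addRight v)).subset ?_
  rintro δ ⟨⟨g, hg⟩, hR⟩
  obtain ⟨v, hv, h⟩ := hg.exists_eq_add (hγ g)
  refine Set.mem_iUnion.2 ⟨g, v, ⟨?_, hv⟩, Homeomorph.ext fun w => (h w).symm⟩
  rw [mem_closedBall_zero_iff]
  have : v = δ z - γ g z := by rw [h z]; abel
  rw [this]
  exact (norm_sub_le _ _).trans (by gcongr)

include hΛ hol in
-- Only finitely many linear parts occur, one for each element of `G`; the sum of their norms serves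
-- them all.
theorem exists_lipschitz_lifts :
    ∃ C : ℝ, 0 ≤ C ∧ ∀ γ ∈ lifts Λ G, ∀ x y, ‖γ x - γ y‖ ≤ C * ‖x - y‖ := by
  obtain ⟨ρ, hρ, -, -⟩ := exists_linearPart hΛ hol
  have := Fintype.ofFinite G
  refine ⟨∑ g, ‖ρ g‖, Finset.sum_nonneg fun _ _ => norm_nonneg _, ?_⟩
  rintro γ ⟨g, hg⟩ x y
  rw [hρ g γ hg x, hρ g γ hg y, add_sub_add_right_eq_sub, ← map_sub]
  refine ((ρ g).le_opNorm _).trans ?_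
  gcongr
  exact Finset.single_le_sum (f := fun g => ‖ρ g‖) (fun _ _ => norm_nonneg _) (Finset.mem_univ g)

include hΛ hol in
theorem exists_slice_lifts (x : Cn n) : ∃ ε : ℝ, 0 < ε ∧ ∀ γ ∈ lifts Λ G,
    ∀ w ∈ Metric.ball x ε, γ w ∈ Metric.ball x ε → γ x = x := by
  obtain ⟨C, hC, hLip⟩ := exists_lipschitz_lifts hΛ hol
  have hfin := finite_lifts (fun g : G => (hol g).continuous) x (‖x‖ + (C + 1))
  have hfin' : ((fun γ : Cn n ≃ₜ Cn n => γ x) '' {γ | γ ∈ lifts Λ G ∧ ‖γ x‖ ≤ ‖x‖ + (C + 1)}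
      \ {x}).Finite := (hfin.image _).sdiff
  obtain ⟨δ, hδ, hball⟩ := Metric.mem_nhds_iff.1
    (hfin'.isClosed.isOpen_compl.mem_nhds (x := x) (by simp))
  -- If `γ` moves `w` within the `ε`-ball, then `‖γ x - x‖ < (C + 1) ε`. The bound `1` puts `γ x`
  -- among the finitely many listed translates, and `δ / (C + 1)` puts it in a ball which meets none
  -- of them except `x`.
  refine ⟨min 1 (δ / (C + 1)), lt_min one_pos (by positivity), fun γ hγ w hw hγw => ?_⟩
  have hdist : ‖γ x - x‖ < (C + 1) * min 1 (δ / (C + 1)) := by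
    rw [Metric.mem_ball, dist_eq_norm] at hw hγw
    have h1 : ‖γ x - x‖ ≤ ‖γ x - γ w‖ + ‖γ w - x‖ := by
      simpa using norm_add_le (γ x - γ w) (γ w - x)
    have h2 := hLip γ hγ x w
    rw [norm_sub_rev] at hw
    nlinarith [mul_le_mul_of_nonneg_left hw.le hC]
  by_contra hne
  have hmem : γ x ∈ Metric.ball x δ := by
    rw [Metric.mem_ball, dist_eq_norm]
    refine hdist.trans_le ?_
    calc (C + 1) * min 1 (δ / (C + 1)) ≤ (C + 1) * (δ / (C + 1)) := by gcongr; exact min_le_right _ _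
      _ = δ := by field_simp
  refine hball hmem ⟨⟨γ, ⟨hγ, ?_⟩, rfl⟩, hne⟩
  have h3 : ‖γ x‖ ≤ ‖x‖ + ‖γ x - x‖ := by simpa using norm_add_le x (γ x - x)
  have h4 : (C + 1) * min 1 (δ / (C + 1)) ≤ (C + 1) * 1 := by gcongr; exact min_le_left _ _
  linarith

end Lifts

/-! ### `Γ_fix`, `G_fix` and the covering of `T / G` -/

instance homeoSubgroup_continuousConstSMul {X : Type*} [TopologicalSpace X]
    (S : Subgroup (X ≃ₜ X)) : ContinuousConstSMul S X :=
  ⟨fun γ => γ.1.continuous⟩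

/-- Two quotient maps with the same fibres have homeomorphic targets. -/
theorem exists_homeomorph_of_isQuotientMap {X Y Z : Type*} [TopologicalSpace X]
    [TopologicalSpace Y] [TopologicalSpace Z] {f : X → Y} {g : X → Z} (hf : IsQuotientMap f)
    (hg : IsQuotientMap g) (h : ∀ x x', f x = f x' ↔ g x = g x') :
    ∃ e : Y ≃ₜ Z, ∀ x, e (f x) = g x := by
  let f' : C(X, Y) := ⟨f, hf.continuous⟩
  let g' : C(X, Z) := ⟨g, hg.continuous⟩
  have hf' : IsQuotientMap f' := hf
  have hg' : IsQuotientMap g' := hg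
  let a : C(Y, Z) := hf'.lift g' fun x x' hx => (h x x').1 hx
  let b : C(Z, Y) := hg'.lift f' fun x x' hx => (h x x').2 hx
  have ha : ∀ x, a (f x) = g x := fun x =>
    congrFun (congrArg DFunLike.coe (hf'.lift_comp g' fun x x' hx => (h x x').1 hx)) x
  have hb : ∀ x, b (g x) = f x := fun x =>
    congrFun (congrArg DFunLike.coe (hg'.lift_comp f' fun x x' hx => (h x x').2 hx)) x
  refine ⟨⟨⟨a, b, fun y => ?_, fun z => ?_⟩, a.continuous, b.continuous⟩, ha⟩
  · obtain ⟨x, rfl⟩ := hf.surjective y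
    rw [ha, hb]
  · obtain ⟨x, rfl⟩ := hg.surjective z
    rw [hb, ha]

section

variable {n : ℕ} {Λ : AddSubgroup (Cn n)} {G : Type*} [Group G] [MulAction G (Cn n ⧸ Λ)]

theorem IsLift.mem_lifts {g : G} {γ : Cn n ≃ₜ Cn n} (h : IsLift Λ g γ) : γ ∈ lifts Λ G := ⟨g, h⟩

theorem IsLift.unique [FaithfulSMul G (Cn n ⧸ Λ)] {g h : G} {γ : Cn n ≃ₜ Cn n}
    (hg : IsLift Λ g γ) (hh : IsLift Λ h γ) : g = h := by
  refine FaithfulSMul.eq_of_smul_eq_smul (α := Cn n ⧸ Λ) fun x => ?_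
  obtain ⟨z, rfl⟩ := QuotientAddGroup.mk_surjective x
  rw [hg z, hh z]

theorem IsLift.mem_groupFix [FaithfulSMul G (Cn n ⧸ Λ)] {g : G} {γ : Cn n ≃ₜ Cn n}
    (hg : IsLift Λ g γ) (hγ : γ ∈ liftsFix Λ G) : g ∈ groupFix Λ G := by
  induction hγ using Subgroup.closure_induction generalizing g with
  | mem γ h =>
    obtain ⟨-, z, hz⟩ := h
    exact Subgroup.subset_closure ⟨z, by rw [hg z, hz]⟩
  | one => rw [hg.unique isLift_one]; exact one_mem _
  | mul a b ha hb iha ihb =>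
    obtain ⟨g₁, h₁⟩ := liftsFix_le Λ G ha
    obtain ⟨g₂, h₂⟩ := liftsFix_le Λ G hb
    rw [hg.unique (h₁.mul h₂)]
    exact mul_mem (iha h₁) (ihb h₂)
  | inv a ha iha =>
    obtain ⟨g₁, h₁⟩ := liftsFix_le Λ G ha
    rw [hg.unique h₁.inv]
    exact inv_mem (iha h₁)

theorem mem_liftsFix_of_apply_eq {γ : Cn n ≃ₜ Cn n} (hγ : γ ∈ lifts Λ G) {z : Cn n}
    (h : γ z = z) : γ ∈ liftsFix Λ G := Subgroup.subset_closure ⟨hγ, z, h⟩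

/-- For a generator fixing `p z`, any lift moves `z` by a lattice vector; translating back gives a
lift fixing `z`. -/
theorem exists_isLift_mem_liftsFix (hlift : ∀ g : G, ∃ γ, IsLift Λ g γ) {g : G}
    (hg : g ∈ groupFix Λ G) : ∃ γ ∈ liftsFix Λ G, IsLift Λ g γ := by
  induction hg using Subgroup.closure_induction with
  | mem g h =>
    obtain ⟨x, hx⟩ := h
    obtain ⟨z, rfl⟩ := QuotientAddGroup.mk_surjective x
    obtain ⟨γ, hγ⟩ := hlift g
    rw [hγ z, QuotientAddGroup.eq] at hx
    have h1 : IsLift Λ g (Homeomorph.addRight (-γ z + z) * γ) := by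
      simpa using (isLift_addRight (G := G) hx).mul hγ
    refine ⟨_, mem_liftsFix_of_apply_eq h1.mem_lifts (z := z) ?_, h1⟩
    change γ z + (-γ z + z) = z
    abel
  | one => exact ⟨1, one_mem _, isLift_one⟩
  | mul a b _ _ iha ihb =>
    obtain ⟨γ, hγ, ha⟩ := iha
    obtain ⟨δ, hδ, hb⟩ := ihb
    exact ⟨γ * δ, mul_mem hγ hδ, ha.mul hb⟩
  | inv a _ iha =>
    obtain ⟨γ, hγ, ha⟩ := iha
    exact ⟨γ⁻¹, inv_mem hγ, ha.inv⟩

theorem conj_mem_liftsFix {γ δ : Cn n ≃ₜ Cn n} (hγ : γ ∈ lifts Λ G) (hδ : δ ∈ liftsFix Λ G) :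
    γ * δ * γ⁻¹ ∈ liftsFix Λ G := by
  induction hδ using Subgroup.closure_induction with
  | mem δ h =>
    obtain ⟨h, z, hz⟩ := h
    refine mem_liftsFix_of_apply_eq (mul_mem (mul_mem hγ h) (inv_mem hγ)) (z := γ z) ?_
    change γ (δ (γ.symm (γ z))) = γ z
    rw [Homeomorph.symm_apply_apply, hz]
  | one => simp
  | mul a b _ _ iha ihb =>
    have := mul_mem iha ihb
    convert! this using 1
    group
  | inv a _ iha =>
    have := inv_mem iha
    rwa [conj_inv] at this

variable (Λ G) in
/-- `Γ_fix` as a subgroup of `Γ`. -/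
noncomputable abbrev fixInLifts : Subgroup (lifts Λ G) := (liftsFix Λ G).subgroupOf (lifts Λ G)

instance fixInLifts_normal : (fixInLifts Λ G).Normal :=
  ⟨fun _ hδ γ => conj_mem_liftsFix γ.2 hδ⟩

/-- The action of `Γ / Γ_fix` on `ℂⁿ / Γ_fix`. -/
noncomputable instance deckAction :
    MulAction (lifts Λ G ⧸ fixInLifts Λ G) (OrbitSpace (liftsFix Λ G) (Cn n)) where
  smul := Quotient.map₂ (fun γ z => γ.1 z) (by
    rintro γ γ' hγ z z' ⟨δ, rfl⟩
    have h : γ⁻¹ * γ' ∈ fixInLifts Λ G := QuotientGroup.leftRel_apply.1 hγ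
    -- This element is `γ δ γ'⁻¹`, which carries `γ' z'` to `γ (δ z')`.
    have h1 := conj_mem_liftsFix γ.2 (mul_mem δ.2 (inv_mem h))
    refine ⟨⟨_, h1⟩, ?_⟩
    change γ.1 (δ.1 (γ'.1.symm (γ.1 (γ.1.symm (γ'.1 z'))))) = γ.1 (δ.1 z')
    simp)
  one_smul y := by
    induction y using Quotient.inductionOn with
    | _ z => rfl
  mul_smul a b y := by
    induction a using QuotientGroup.induction_on with
    | _ a =>
      induction b using QuotientGroup.induction_on with
      | _ b =>
        induction y using Quotient.inductionOn with
        | _ z => rfl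

theorem coverMap_mk (z : Cn n) :
    coverMap Λ G (orbitMk (liftsFix Λ G) z) = orbitMk G (z : Cn n ⧸ Λ) := rfl

theorem isOpenQuotientMap_orbitMk_liftsFix :
    IsOpenQuotientMap (orbitMk (liftsFix Λ G) : Cn n → _) :=
  MulAction.isOpenQuotientMap_quotientMk

theorem orbitMk_mk_eq_iff (hlift : ∀ g : G, ∃ γ, IsLift Λ g γ) {z w : Cn n} :
    orbitMk G (z : Cn n ⧸ Λ) = orbitMk G (w : Cn n ⧸ Λ) ↔ ∃ γ ∈ lifts Λ G, γ w = z := by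
  rw [orbitMk_eq_iff]
  constructor
  · rintro ⟨g, hg⟩
    obtain ⟨γ, hγ⟩ := hlift g
    rw [hγ w, QuotientAddGroup.eq] at hg
    refine ⟨Homeomorph.addRight (-γ w + z) * γ,
      ((isLift_addRight (G := G) hg).mul hγ).mem_lifts, ?_⟩
    change γ w + (-γ w + z) = z
    abel
  · rintro ⟨γ, ⟨g, hg⟩, rfl⟩
    exact ⟨g, hg w⟩

/-- Evenly covered neighbourhoods come from slices. If `γ` moves the image of a slice at `x` so that
it meets itself, then `δ γ` fixes `x` for some `δ ∈ Γ_fix`; hence `δ γ`, and so `γ`, is in `Γ_fix`.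
-/
theorem isQuotientCoveringMap_coverMap (hlift : ∀ g : G, ∃ γ, IsLift Λ g γ)
    (hc : ∀ g : G, Continuous fun x : Cn n ⧸ Λ => g • x)
    (hslice : ∀ x : Cn n, ∃ ε : ℝ, 0 < ε ∧ ∀ γ ∈ lifts Λ G,
      ∀ w ∈ Metric.ball x ε, γ w ∈ Metric.ball x ε → γ x = x) :
    IsQuotientCoveringMap (coverMap Λ G) (lifts Λ G ⧸ fixInLifts Λ G) := by
  have : ContinuousConstSMul G (Cn n ⧸ Λ) := ⟨hc⟩
  have hq := isOpenQuotientMap_orbitMk_liftsFix (Λ := Λ) (G := G)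
  have hT : IsOpenQuotientMap (orbitMk G : Cn n ⧸ Λ → _) := MulAction.isOpenQuotientMap_quotientMk
  have hcomp : IsQuotientMap (coverMap Λ G ∘ orbitMk (liftsFix Λ G)) :=
    hT.isQuotientMap.comp (isQuotientMap_quotient_mk' (s := QuotientAddGroup.leftRel Λ))
  have hcont : Continuous (coverMap Λ G) := hq.isQuotientMap.continuous_iff.2 hcomp.continuous
  refine { toIsQuotientMap := .of_comp hq.continuous hcont hcomp, continuous_const_smul := ?_,
           apply_eq_iff_mem_orbit := ?_, disjoint := ?_ }
  · intro k
    obtain ⟨γ, rfl⟩ := QuotientGroup.mk_surjective k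
    exact hq.isQuotientMap.continuous_iff.2 (hq.continuous.comp γ.1.continuous)
  · intro y y'
    obtain ⟨z, rfl⟩ := hq.surjective y
    obtain ⟨w, rfl⟩ := hq.surjective y'
    rw [coverMap_mk, coverMap_mk, orbitMk_mk_eq_iff hlift]
    constructor
    · rintro ⟨γ, hγ, rfl⟩
      exact ⟨((⟨γ, hγ⟩ : lifts Λ G) : lifts Λ G ⧸ fixInLifts Λ G), rfl⟩
    · rintro ⟨k, hk⟩
      obtain ⟨γ, rfl⟩ := QuotientGroup.mk_surjective k
      obtain ⟨δ, hδ⟩ := orbitMk_eq_iff.1 hk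
      exact ⟨δ.1⁻¹ * γ.1, mul_mem (inv_mem (liftsFix_le Λ G δ.2)) γ.2,
        (Homeomorph.symm_apply_eq _).2 hδ.symm⟩
  · intro y
    obtain ⟨x, rfl⟩ := hq.surjective y
    obtain ⟨ε, hε, h⟩ := hslice x
    refine ⟨orbitMk (liftsFix Λ G) '' Metric.ball x ε,
      hq.isOpenMap.image_mem_nhds (Metric.ball_mem_nhds x hε), fun k hk => ?_⟩
    obtain ⟨γ, rfl⟩ := QuotientGroup.mk_surjective k
    obtain ⟨_, ⟨_, ⟨w, hw, rfl⟩, rfl⟩, w', hw', hww'⟩ := hk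
    obtain ⟨δ, hδ⟩ := orbitMk_eq_iff.1 hww'
    have h1' : δ.1 (γ.1 w) = w' := hδ
    have h2 := mul_mem (liftsFix_le Λ G δ.2) γ.2
    have h3 : δ.1 * γ.1 ∈ liftsFix Λ G := mem_liftsFix_of_apply_eq h2 (h _ h2 w hw (h1' ▸ hw'))
    refine (QuotientGroup.eq_one_iff γ).2 ?_
    have h4 := mul_mem (inv_mem δ.2) h3
    rwa [inv_mul_cancel_left] at h4

theorem simplyConnectedSpace_liftsFix
    (haff : ∀ γ ∈ lifts Λ G, ∃ L : Cn n →L[ℂ] Cn n, ∀ z, γ z = L z + γ 0)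
    (hslice : ∀ x : Cn n, ∃ ε : ℝ, 0 < ε ∧ ∀ γ ∈ lifts Λ G,
      ∀ w ∈ Metric.ball x ε, γ w ∈ Metric.ball x ε → γ x = x) :
    SimplyConnectedSpace (OrbitSpace (liftsFix Λ G) (Cn n)) := by
  refine simplyConnectedSpace_orbitSpace (fun γ x v t => ?_) (fun x => ?_) ?_
  · obtain ⟨L, hL⟩ := haff γ.1 (liftsFix_le Λ G γ.2)
    change γ.1 (x + t • v) - γ.1 x = t • (γ.1 (x + v) - γ.1 x)
    rw [hL (x + t • v), hL x, hL (x + v), add_sub_add_right_eq_sub, add_sub_add_right_eq_sub,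
      map_add, map_add, add_sub_cancel_left, add_sub_cancel_left]
    exact (L.restrictScalars ℝ).map_smul t v
  · obtain ⟨ε, hε, h⟩ := hslice x
    exact ⟨ε, hε, fun γ => h γ.1 (liftsFix_le Λ G γ.2)⟩
  · have h := Subgroup.closure_closure_coe_preimage
      (k := {γ : Cn n ≃ₜ Cn n | γ ∈ lifts Λ G ∧ ∃ z, γ z = z})
    exact top_unique (h.symm.trans_le (Subgroup.closure_mono fun γ hγ => hγ.2))

variable [DiscreteTopology Λ]

/-- Both spaces are quotients of `ℂⁿ` with the same fibres, because translations by `Λ'` already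
belong to `Γ_fix`. -/
theorem exists_homeomorph_orbitSpace_fixTorus :
    ∃ h₁ : OrbitSpace (liftsFix Λ G) (Cn n) ≃ₜ
        OrbitSpace (liftsFix Λ G ⧸ fixTranslations Λ G) (FixTorus Λ G),
      ∀ z : Cn n, h₁ (orbitMk (liftsFix Λ G) z) =
        orbitMk (liftsFix Λ G ⧸ fixTranslations Λ G) (z : FixTorus Λ G) := by
  refine exists_homeomorph_of_isQuotientMap (f := orbitMk (liftsFix Λ G))
    (g := fun z : Cn n => orbitMk (liftsFix Λ G ⧸ fixTranslations Λ G) (z : FixTorus Λ G))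
    isOpenQuotientMap_orbitMk_liftsFix.isQuotientMap
    (isQuotientMap_quotient_mk'.comp isQuotientMap_quotient_mk') fun z w => ?_
  rw [orbitMk_eq_iff, orbitMk_eq_iff]
  constructor
  · rintro ⟨γ, rfl⟩
    exact ⟨γ, rfl⟩
  · rintro ⟨k, hk⟩
    obtain ⟨γ, rfl⟩ := QuotientGroup.mk_surjective k
    rw [fixTorusAction_mk, QuotientAddGroup.eq] at hk
    refine ⟨⟨_, hk.2⟩ * γ, ?_⟩
    change γ.1 w + (-γ.1 w + z) = z
    abel

/-- By faithfulness a lift determines its element of `G`, giving a homomorphism; its kernel consists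
of lifts of the identity, which are translations. -/
theorem exists_mulEquiv_groupFix [FaithfulSMul G (Cn n ⧸ Λ)]
    (hlift : ∀ g : G, ∃ γ, IsLift Λ g γ) :
    ∃ e : (liftsFix Λ G ⧸ fixTranslations Λ G) ≃* groupFix Λ G,
      ∀ γ : liftsFix Λ G, IsLift Λ (e γ : G) γ := by
  choose f hf using fun γ : liftsFix Λ G => liftsFix_le Λ G γ.2
  let φ : liftsFix Λ G →* groupFix Λ G := MonoidHom.mk'
    (fun γ => ⟨f γ, (hf γ).mem_groupFix γ.2⟩)
    (fun a b => Subtype.ext ((hf (a * b)).unique ((hf a).mul (hf b))))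
  have hφ : Function.Surjective φ := by
    rintro ⟨g, hg⟩
    obtain ⟨γ, hγ, h⟩ := exists_isLift_mem_liftsFix hlift hg
    exact ⟨⟨γ, hγ⟩, Subtype.ext ((hf ⟨γ, hγ⟩).unique h)⟩
  have hker : fixTranslations Λ G = φ.ker := by
    ext γ
    constructor
    · rintro ⟨v, hv, h⟩
      refine Subtype.ext ((hf γ).unique (h := (1 : G)) fun z => ?_)
      rw [h z, one_smul, mk_add_of_mem z hv.1]
    · intro h
      have h1 : f γ = 1 := congrArg Subtype.val h
      obtain ⟨v, hv, h2⟩ := exists_translation Λ γ.1 fun z => by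
        rw [← hf γ z, h1, one_smul]
      refine ⟨v, ⟨hv, ?_⟩, h2⟩
      convert! γ.2
      ext1 z
      exact (h2 z).symm
  exact ⟨(QuotientGroup.quotientMulEquivOfEq hker).trans
    (QuotientGroup.quotientKerEquivOfSurjective φ hφ), hf⟩

/-- Transport of an action along an isomorphism of groups does not change the orbit space. -/
theorem exists_homeomorph_compHom {K H X : Type*} [Group K] [Group H] [TopologicalSpace X]
    [MulAction K X] (e : K ≃* H) :
    letI : MulAction H X := MulAction.compHom X e.symm.toMonoidHom
    ∃ h : OrbitSpace K X ≃ₜ OrbitSpace H X, ∀ x, h (orbitMk K x) = orbitMk H x := by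
  let : MulAction H X := MulAction.compHom X e.symm.toMonoidHom
  refine exists_homeomorph_of_isQuotientMap (f := orbitMk K) (g := orbitMk H)
    isQuotientMap_quotient_mk' isQuotientMap_quotient_mk' fun x y => ?_
  rw [orbitMk_eq_iff, orbitMk_eq_iff]
  constructor
  · rintro ⟨k, rfl⟩
    refine ⟨e k, ?_⟩
    change e.symm (e k) • y = _
    rw [e.symm_apply_apply]
  · rintro ⟨g, rfl⟩
    exact ⟨e.symm g, rfl⟩

omit [DiscreteTopology Λ] in
theorem addRight_mem_liftsFix_of_lifts_le (hlift : ∀ g : G, ∃ γ, IsLift Λ g γ)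
    {g : G} (h : ∀ γ : Cn n ≃ₜ Cn n, IsLift Λ g γ → γ ∈ liftsFix Λ G) {v : Cn n} (hv : v ∈ Λ) :
    Homeomorph.addRight v ∈ liftsFix Λ G := by
  obtain ⟨γ, hγ⟩ := hlift g
  -- Two lifts of `g` in `Γ_fix` whose quotient is the translation by `v`.
  have h1 : IsLift Λ g (Homeomorph.addRight v * γ) := by
    simpa using (isLift_addRight (G := G) hv).mul hγ
  simpa using mul_mem (h _ h1) (inv_mem (h γ hγ))

/-- An element of `Γ` over `G_fix` differs by a lattice translation from one in `Γ_fix`; as `Γ_fix`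
contains these translations, it is the full preimage of `G_fix`. -/
theorem nonempty_lifts_quotient_mulEquiv [FaithfulSMul G (Cn n ⧸ Λ)]
    (hlift : ∀ g : G, ∃ γ, IsLift Λ g γ) (h : ∀ v ∈ Λ, Homeomorph.addRight v ∈ liftsFix Λ G) :
    Nonempty ((lifts Λ G ⧸ fixInLifts Λ G) ≃* G ⧸ groupFix Λ G) := by
  choose f hf using fun γ : lifts Λ G => γ.2
  let π : lifts Λ G →* G := MonoidHom.mk' f fun a b => (hf (a * b)).unique ((hf a).mul (hf b))
  let φ : lifts Λ G →* G ⧸ groupFix Λ G := (QuotientGroup.mk' (groupFix Λ G)).comp π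
  have hφ : Function.Surjective φ := by
    refine (QuotientGroup.mk'_surjective _).comp fun g => ?_
    obtain ⟨γ, hγ⟩ := hlift g
    exact ⟨⟨γ, hγ.mem_lifts⟩, (hf ⟨γ, hγ.mem_lifts⟩).unique hγ⟩
  have hker : fixInLifts Λ G = φ.ker := by
    ext γ
    rw [MonoidHom.mem_ker]
    refine Iff.trans ?_ (QuotientGroup.eq_one_iff (f γ)).symm
    constructor
    · exact fun hγ => (hf γ).mem_groupFix hγ
    · intro hg
      obtain ⟨δ, hδ, hδg⟩ := exists_isLift_mem_liftsFix hlift hg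
      obtain ⟨v, hv, hv'⟩ := (hf γ).exists_eq_add hδg
      have h1 : γ.1 = Homeomorph.addRight v * δ := Homeomorph.ext hv'
      rw [Subgroup.mem_subgroupOf, h1]
      exact mul_mem (h v hv) hδ
  exact ⟨(QuotientGroup.quotientMulEquivOfEq hker).trans
    (QuotientGroup.quotientKerEquivOfSurjective φ hφ)⟩

end

/-! ### Compactness of `ℂⁿ / Γ_fix` and of `T'` -/

/-- In a compact orbit space of `ℂⁿ`, every orbit meets a fixed ball. -/
theorem exists_bound_of_compactSpace_orbitSpace {n : ℕ} (S : Subgroup (Cn n ≃ₜ Cn n))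
    [CompactSpace (OrbitSpace S (Cn n))] : ∃ R : ℝ, ∀ z : Cn n, ∃ γ ∈ S, ‖γ z‖ ≤ R := by
  have hq : IsOpenQuotientMap (orbitMk S : Cn n → _) := MulAction.isOpenQuotientMap_quotientMk
  have hmono : Monotone fun m : ℕ => orbitMk S '' Metric.ball (0 : Cn n) m := fun a b hab =>
    Set.image_mono (Metric.ball_subset_ball (Nat.cast_le.2 hab))
  obtain ⟨m, hm⟩ := isCompact_univ.elim_directed_cover
    (fun m : ℕ => orbitMk S '' Metric.ball (0 : Cn n) m)
    (fun m => hq.isOpenMap _ Metric.isOpen_ball) (fun y _ => by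
      obtain ⟨z, rfl⟩ := hq.surjective y
      obtain ⟨m, hm⟩ := exists_nat_gt ‖z‖
      exact Set.mem_iUnion.2 ⟨m, z, by simpa using hm, rfl⟩) hmono.directed_le
  refine ⟨m, fun z => ?_⟩
  obtain ⟨w, hw, hwz⟩ := hm (Set.mem_univ (orbitMk S z))
  obtain ⟨γ, hγ⟩ := orbitMk_eq_iff.1 hwz
  refine ⟨γ.1, γ.2, ?_⟩
  have : γ.1 z = w := hγ
  rw [this]
  exact (mem_ball_zero_iff.1 hw).le

section FixTorus

variable {n : ℕ} {Λ : AddSubgroup (Cn n)} {G : Type*} [Group G] [MulAction G (Cn n ⧸ Λ)]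
  [DiscreteTopology Λ]

/-- If all orbits meet a closed ball, the images of this ball under finitely many coset
representatives of `Λ'` cover `T'`. Conversely, the orbit space is a quotient of `T'`. -/
theorem compactSpace_orbitSpace_iff_compactSpace_fixTorus
    [Finite (liftsFix Λ G ⧸ fixTranslations Λ G)] :
    CompactSpace (OrbitSpace (liftsFix Λ G) (Cn n)) ↔ CompactSpace (FixTorus Λ G) := by
  constructor
  · intro hcpt
    obtain ⟨R, hR⟩ := exists_bound_of_compactSpace_orbitSpace (liftsFix Λ G)
    have hK : IsCompact (⋃ k : liftsFix Λ G ⧸ fixTranslations Λ G,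
        (fun z : Cn n => ((k.out.1 z : Cn n) : FixTorus Λ G)) '' Metric.closedBall 0 R) :=
      isCompact_iUnion fun k => (isCompact_closedBall 0 R).image
        (continuous_quotient_mk'.comp k.out.1.continuous)
    refine ⟨hK.of_isClosed_subset isClosed_univ fun x _ => ?_⟩
    obtain ⟨z, rfl⟩ := QuotientAddGroup.mk_surjective x
    obtain ⟨γ, hγ, hz⟩ := hR z
    let δ : liftsFix Λ G := ⟨γ, hγ⟩
    refine Set.mem_iUnion.2 ⟨((δ⁻¹ : liftsFix Λ G) : liftsFix Λ G ⧸ fixTranslations Λ G), γ z,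
      mem_closedBall_zero_iff.2 hz, ?_⟩
    dsimp only
    rw [← fixTorusAction_mk, QuotientGroup.out_eq', fixTorusAction_mk]
    exact congrArg _ (γ.symm_apply_apply z)
  · intro hcpt
    obtain ⟨h₁, -⟩ := exists_homeomorph_orbitSpace_fixTorus (Λ := Λ) (G := G)
    exact h₁.symm.compactSpace

end FixTorus

/-! ### The topology of the Euclidean group -/

section EuclideanGroup

variable {V : Type*} [NormedAddCommGroup V] [NormedSpace ℝ V]

theorem continuous_affineIsometryEquiv_apply (v : V) :
    Continuous fun φ : V ≃ᵃⁱ[ℝ] V => φ v := by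
  have h : Continuous fun φ : V ≃ᵃⁱ[ℝ] V =>
      (φ 0, (φ.linearIsometryEquiv.toContinuousLinearEquiv : V →L[ℝ] V)) :=
    continuous_induced_dom
  have h1 : Continuous fun φ : V ≃ᵃⁱ[ℝ] V =>
      (φ.linearIsometryEquiv.toContinuousLinearEquiv : V →L[ℝ] V) v + φ 0 :=
    ((ContinuousLinearMap.apply ℝ V v).continuous.comp h.snd).add h.fst
  convert! h1 using 2 with φ
  simpa using φ.map_vadd 0 v

/-- Applying the isometry `ψ` turns the distance from `ψ⁻¹ 0` to `φ⁻¹ 0` into that from `0` to `ψ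
(φ⁻¹ 0)`, so continuity of an evaluation suffices. -/
theorem continuous_affineIsometryEquiv_inv_zero :
    Continuous fun φ : V ≃ᵃⁱ[ℝ] V => φ⁻¹ 0 := by
  rw [continuous_iff_continuousAt]
  intro φ
  have h := (continuous_affineIsometryEquiv_apply (φ⁻¹ 0)).tendsto φ
  rw [tendsto_iff_dist_tendsto_zero] at h
  refine tendsto_iff_dist_tendsto_zero.2 (h.congr fun ψ => ?_)
  have e : φ (φ⁻¹ 0) = 0 := φ.apply_symm_apply 0
  have e' : ψ (ψ⁻¹ 0) = 0 := ψ.apply_symm_apply 0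
  change dist (ψ (φ⁻¹ 0)) (φ (φ⁻¹ 0)) = dist (ψ⁻¹ 0) (φ⁻¹ 0)
  rw [e, ← ψ.dist_map (ψ⁻¹ 0), e', dist_comm]

instance euclideanGroup_t2Space : T2Space (V ≃ᵃⁱ[ℝ] V) := by
  refine T2Space.of_injective_continuous (f := fun (φ : V ≃ᵃⁱ[ℝ] V) (v : V) => φ v)
    (fun φ ψ h => AffineIsometryEquiv.ext (congrFun h))
    (continuous_pi continuous_affineIsometryEquiv_apply)

theorem isCompact_setOf_norm_apply_zero_le [FiniteDimensional ℝ V] (R : ℝ) :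
    IsCompact {φ : V ≃ᵃⁱ[ℝ] V | ‖φ 0‖ ≤ R} := by
  let i : (V ≃ᵃⁱ[ℝ] V) → V × (V →L[ℝ] V) := fun φ =>
    (φ 0, (φ.linearIsometryEquiv.toContinuousLinearEquiv : V →L[ℝ] V))
  have hi : IsInducing i := ⟨rfl⟩
  have : ProperSpace V := FiniteDimensional.proper ℝ V
  have : ProperSpace (V →L[ℝ] V) := FiniteDimensional.proper ℝ _
  let O : Set (V →L[ℝ] V) := {L | ∀ v, ‖L v‖ = ‖v‖}
  have hO : IsCompact O := by
    refine (isCompact_closedBall 0 1).of_isClosed_subset ?_ fun L hL => ?_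
    · have : O = ⋂ v, {L | ‖L v‖ = ‖v‖} := by ext; simp [O]
      rw [this]
      exact isClosed_iInter fun v => isClosed_eq
        (ContinuousLinearMap.apply ℝ V v).continuous.norm continuous_const
    · rw [mem_closedBall_zero_iff]
      exact L.opNorm_le_bound zero_le_one fun v => by rw [hL v, one_mul]
  rw [hi.isCompact_iff]
  convert! (isCompact_closedBall (0 : V) R).prod hO using 1
  ext ⟨b, L⟩
  constructor
  · rintro ⟨φ, hφ, h⟩
    obtain ⟨rfl, rfl⟩ := Prod.ext_iff.1 h
    exact ⟨mem_closedBall_zero_iff.2 hφ, fun v => φ.linearIsometryEquiv.norm_map v⟩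
  · rintro ⟨hb, hL⟩
    -- Finite dimension makes the isometry `L` surjective.
    let L' : V ≃ₗᵢ[ℝ] V := LinearIsometry.toLinearIsometryEquiv ⟨L.toLinearMap, hL⟩ rfl
    let φ : V ≃ᵃⁱ[ℝ] V := AffineIsometryEquiv.mk' (fun v => L v + b) L' 0 fun v => by
      change L v + b = L (v - 0) + (L 0 + b)
      simp
    have h0 : φ 0 = b := by
      change L 0 + b = b
      simp
    refine ⟨φ, ?_, Prod.ext h0 ?_⟩
    · change ‖φ 0‖ ≤ R
      rw [h0]
      exact mem_closedBall_zero_iff.1 hb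
    · ext v
      rfl

theorem isCrystallographic_of_finite [FiniteDimensional ℝ V] (D : Subgroup (V ≃ᵃⁱ[ℝ] V))
    (hfin : ∀ r : ℝ, {φ | φ ∈ D ∧ ‖φ 0‖ < r}.Finite) (R : ℝ) (hR : ∀ v, ∃ φ ∈ D, ‖φ v‖ ≤ R) :
    IsCrystallographic D := by
  constructor
  · rw [discreteTopology_iff_isOpen_singleton]
    intro φ
    have hopen : IsOpen {ψ : D | ‖ψ.1 0‖ < ‖φ.1 0‖ + 1} :=
      isOpen_lt ((continuous_affineIsometryEquiv_apply 0).comp continuous_subtype_val).norm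
        continuous_const
    refine isOpen_singleton_of_finite_mem_nhds φ (hopen.mem_nhds (by simp)) ?_
    refine Set.Finite.of_finite_image ((hfin (‖φ.1 0‖ + 1)).subset ?_) Subtype.val_injective.injOn
    rintro _ ⟨ψ, hψ, rfl⟩
    exact ⟨ψ.2, hψ⟩
  · have hK := (isCompact_setOf_norm_apply_zero_le (V := V) R).image
      (continuous_quotient_mk' (s := QuotientGroup.leftRel D))
    refine isCompact_univ_iff.1 ?_
    convert! hK using 1
    refine (Set.eq_univ_of_forall fun x => ?_).symm
    obtain ⟨φ, rfl⟩ := QuotientGroup.mk_surjective x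
    -- The representative `φ ψ⁻¹` of the coset of `φ` moves `0` by `‖ψ (φ⁻¹ 0)‖ ≤ R`, hence lies in
    -- a fixed compact set.
    obtain ⟨ψ, hψ, h⟩ := hR (φ⁻¹ 0)
    refine ⟨φ * ψ⁻¹, ?_, QuotientGroup.eq.2 (by simpa using hψ)⟩
    have e : φ (φ⁻¹ 0) = 0 := φ.apply_symm_apply 0
    have e' : ψ (ψ⁻¹ 0) = 0 := ψ.apply_symm_apply 0
    change ‖φ (ψ⁻¹ 0)‖ ≤ R
    rw [← dist_zero_right] at h ⊢
    nth_rewrite 2 [← e]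
    nth_rewrite 2 [← e'] at h
    rwa [φ.dist_map, dist_comm, ← ψ.dist_map]

end EuclideanGroup

/-! ### Unitarising the linear parts -/

section Averaging

variable {n : ℕ} {G : Type*} [Group G] [Finite G]

/-- A finite group of linear automorphisms of `ℂⁿ` is unitary after a change of coordinates. -/
theorem exists_continuousLinearEquiv_norm_map (ρ : G → (Cn n →L[ℂ] Cn n)) (h1 : ∀ v, ρ 1 v = v)
    (hmul : ∀ g h v, ρ (g * h) v = ρ g (ρ h v)) :
    ∃ A : Cn n ≃L[ℂ] Cn n, ∀ g v, ‖A (ρ g v)‖ = ‖A v‖ := by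
  have := Fintype.ofFinite G
  -- `‖J v‖` is the averaged Hermitian norm up to scale; `A` reads `J v` in an orthonormal basis of
  -- the image. Right multiplication by `h` merely permutes the summands.
  let J : Cn n →ₗ[ℂ] PiLp 2 (fun _ : G => Cn n) :=
    { toFun v := WithLp.toLp 2 fun g => ρ g v
      map_add' v w := by ext; simp
      map_smul' c v := by ext; simp }
  have hJ : Function.Injective J := fun v w h => by
    have h2 : ρ 1 v = ρ 1 w := congrArg (fun x : PiLp 2 (fun _ : G => Cn n) => x 1) h
    rwa [h1, h1] at h2
  let e : Cn n ≃ₗ[ℂ] LinearMap.range J := LinearEquiv.ofInjective J hJ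
  have hdim : Module.finrank ℂ (LinearMap.range J) = n := by
    rw [← e.finrank_eq, finrank_euclideanSpace_fin]
  let B := (stdOrthonormalBasis ℂ (LinearMap.range J)).reindex (finCongr hdim)
  let A : Cn n ≃L[ℂ] Cn n := (e.trans B.repr.toLinearEquiv).toContinuousLinearEquiv
  have hA : ∀ v, ‖A v‖ = ‖J v‖ := fun v => B.repr.norm_map (e v)
  refine ⟨A, fun h v => ?_⟩
  rw [hA, hA, PiLp.norm_eq_of_L2, PiLp.norm_eq_of_L2]
  congr 1
  refine Fintype.sum_equiv (Equiv.mulRight h) _ _ fun g => ?_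
  change ‖ρ g (ρ h v)‖ ^ 2 = ‖ρ (g * h) v‖ ^ 2
  rw [hmul]

end Averaging

/-! ### Crystallographic groups and compact orbit spaces -/

section Crystallographic

variable {n : ℕ} {Λ : AddSubgroup (Cn n)} {G : Type*} [Group G] [MulAction G (Cn n ⧸ Λ)]

/-- The compact coset space of `D` maps onto the orbit space by `φ ↦ φ⁻¹ 0`, read through `A`. The
inverse turns left cosets into orbits, and translations give surjectivity. -/
theorem IsCrystallographicGroup.compactSpace_orbitSpace {S : Subgroup (Cn n ≃ₜ Cn n)}
    (hS : IsCrystallographicGroup S) : CompactSpace (OrbitSpace S (Cn n)) := by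
  obtain ⟨A, D, ⟨-, hD⟩, h⟩ := hS
  let F : (Cn n ≃ᵃⁱ[ℝ] Cn n) ⧸ D → OrbitSpace S (Cn n) :=
    Quotient.lift (fun φ => orbitMk S (A.symm (φ⁻¹ 0))) (by
      intro φ ψ hφψ
      have hd : φ⁻¹ * ψ ∈ D := QuotientGroup.leftRel_apply.1 hφψ
      let γ : Cn n ≃ₜ Cn n :=
        A.toHomeomorph.trans ((φ⁻¹ * ψ).toHomeomorph.trans A.toHomeomorph.symm)
      have hγ : ∀ z, A (γ z) = (φ⁻¹ * ψ) (A z) := fun z => A.apply_symm_apply _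
      refine orbitMk_eq_iff.2 ⟨⟨γ, (h γ).2 ⟨_, hd, hγ⟩⟩, A.injective ?_⟩
      refine (hγ _).trans ?_
      rw [A.apply_symm_apply, A.apply_symm_apply]
      change φ⁻¹ (ψ (ψ⁻¹ 0)) = _
      rw [show ψ (ψ⁻¹ 0) = 0 from ψ.apply_symm_apply 0])
  have hF : Continuous F := by
    have hq : IsQuotientMap (QuotientGroup.mk : (Cn n ≃ᵃⁱ[ℝ] Cn n) → _ ⧸ D) :=
      isQuotientMap_quotient_mk'
    exact hq.continuous_iff.2 (continuous_quotient_mk'.comp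
      (A.symm.continuous.comp continuous_affineIsometryEquiv_inv_zero))
  have hsurj : Function.Surjective F := by
    intro y
    obtain ⟨z, rfl⟩ := Quotient.exists_rep y
    refine ⟨((AffineIsometryEquiv.constVAdd ℝ (Cn n) (A z))⁻¹ : Cn n ≃ᵃⁱ[ℝ] Cn n), ?_⟩
    change orbitMk S (A.symm ((AffineIsometryEquiv.constVAdd ℝ (Cn n) (A z))⁻¹⁻¹ 0)) = orbitMk S z
    rw [inv_inv, AffineIsometryEquiv.coe_constVAdd]
    simp
  rw [← isCompact_univ_iff, ← hsurj.range_eq]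
  exact isCompact_range hF

variable [DiscreteTopology Λ] [Finite G]

theorem isCrystallographicGroup_liftsFix (hΛ : Submodule.span ℝ (Λ : Set (Cn n)) = ⊤)
    (hol : ∀ g : G, IsHolomorphicMap Λ (fun x => g • x))
    [CompactSpace (OrbitSpace (liftsFix Λ G) (Cn n))] :
    IsCrystallographicGroup (liftsFix Λ G) := by
  obtain ⟨ρ, hρ, h1, hmul⟩ := exists_linearPart hΛ hol
  obtain ⟨A, hA⟩ := exists_continuousLinearEquiv_norm_map ρ h1 hmul
  obtain ⟨R, hR⟩ := exists_bound_of_compactSpace_orbitSpace (liftsFix Λ G)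
  let D : Subgroup (Cn n ≃ᵃⁱ[ℝ] Cn n) :=
    { carrier := {φ | ∃ γ ∈ liftsFix Λ G, ∀ z, A (γ z) = φ (A z)}
      one_mem' := ⟨1, one_mem _, fun z => rfl⟩
      mul_mem' := by
        rintro φ ψ ⟨γ, hγ, h⟩ ⟨δ, hδ, h'⟩
        refine ⟨γ * δ, mul_mem hγ hδ, fun z => ?_⟩
        change A (γ (δ z)) = φ (ψ (A z))
        rw [h, h']
      inv_mem' := by
        rintro φ ⟨γ, hγ, h⟩
        refine ⟨γ⁻¹, inv_mem hγ, fun z => φ.injective ?_⟩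
        have e : γ (γ⁻¹ z) = z := γ.apply_symm_apply z
        rw [← h, e]
        exact (φ.apply_symm_apply (A z)).symm }
  have hDS : ∀ γ ∈ liftsFix Λ G, ∃ φ ∈ D, ∀ z, A (γ z) = φ (A z) := by
    intro γ hγ
    obtain ⟨g, hg⟩ := liftsFix_le Λ G hγ
    let L : Cn n →ₗ[ℝ] Cn n :=
      (A.toLinearMap ∘ₗ (ρ g).toLinearMap ∘ₗ A.symm.toLinearMap).restrictScalars ℝ
    have hL : ∀ v, ‖L v‖ = ‖v‖ := fun v => by
      change ‖A (ρ g (A.symm v))‖ = ‖v‖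
      rw [hA, A.apply_symm_apply]
    let φ : Cn n ≃ᵃⁱ[ℝ] Cn n := AffineIsometryEquiv.mk' (fun v => A (γ (A.symm v)))
      (LinearIsometry.toLinearIsometryEquiv ⟨L, hL⟩ rfl) 0 fun v => by
        change A (γ (A.symm v)) = A (ρ g (A.symm (v - 0))) + A (γ (A.symm 0))
        rw [hρ g γ hg, map_add, sub_zero, A.symm.map_zero]
    have hφ : ∀ z, A (γ z) = φ (A z) := fun z => by
      change A (γ z) = A (γ (A.symm (A z)))
      rw [A.symm_apply_apply]
    exact ⟨φ, ⟨γ, hγ, hφ⟩, hφ⟩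
  refine ⟨A, D, ?_, fun γ => ⟨hDS γ, ?_⟩⟩
  · refine isCrystallographic_of_finite D (fun r => ?_) (‖(A : Cn n →L[ℂ] Cn n)‖ * R) fun v => ?_
    · have hfin := finite_lifts (fun g : G => (hol g).continuous) 0
        (‖(A.symm : Cn n →L[ℂ] Cn n)‖ * r)
      -- Finiteness transfers from lifts to motions because `γ` determines `φ`.
      refine (hfin.biUnion (t := fun γ => {φ : Cn n ≃ᵃⁱ[ℝ] Cn n | ∀ z, A (γ z) = φ (A z)})
        fun γ _ => Set.Subsingleton.finite fun φ hφ ψ hψ => ?_).subset ?_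
      · refine AffineIsometryEquiv.ext fun v => ?_
        obtain ⟨z, rfl⟩ := A.surjective v
        rw [← hφ z, ← hψ z]
      · rintro φ ⟨⟨γ, hγ, h⟩, hr⟩
        refine Set.mem_biUnion (x := γ) ⟨liftsFix_le Λ G hγ, ?_⟩ h
        have h0 : γ 0 = A.symm (φ 0) := by
          rw [← A.map_zero, ← h, A.symm_apply_apply, A.map_zero]
        rw [h0]
        exact ((A.symm : Cn n →L[ℂ] Cn n).le_opNorm _).trans (by gcongr)
    · obtain ⟨z, rfl⟩ := A.surjective v
      obtain ⟨γ, hγ, hz⟩ := hR z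
      obtain ⟨φ, hφ, h⟩ := hDS γ hγ
      refine ⟨φ, hφ, ?_⟩
      rw [← h]
      exact ((A : Cn n →L[ℂ] Cn n).le_opNorm _).trans (by gcongr)
  · rintro ⟨φ, ⟨δ, hδ, h⟩, h'⟩
    have : γ = δ := Homeomorph.ext fun z => A.injective ((h' z).trans (h z).symm)
    rwa [this]

end Crystallographic

end TorusQuotient

open TorusQuotient in
theorem mainTheorem12 {n : ℕ} (Λ : AddSubgroup (Cn n)) [DiscreteTopology Λ]
    (hΛ : Submodule.span ℝ (Λ : Set (Cn n)) = ⊤)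
    {G : Type*} [Group G] [Finite G] [MulAction G (Cn n ⧸ Λ)] [FaithfulSMul G (Cn n ⧸ Λ)]
    (hol : ∀ g : G, IsHolomorphicMap Λ (fun x => g • x)) :
    -- `ℂⁿ / Γ_fix → T / G` is the universal cover
    IsUniversalCover (coverMap Λ G) ∧
    -- `ℂⁿ / Γ_fix ≃ (ℂⁿ / Λ') / (Γ_fix / Λ')`, induced by the identity of `ℂⁿ`
    (∃ h₁ : OrbitSpace (liftsFix Λ G) (Cn n) ≃ₜ
        OrbitSpace (liftsFix Λ G ⧸ fixTranslations Λ G) (FixTorus Λ G),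
      ∀ z : Cn n, h₁ (orbitMk (liftsFix Λ G) z) =
        orbitMk (liftsFix Λ G ⧸ fixTranslations Λ G) (z : FixTorus Λ G)) ∧
    -- `Γ_fix / Λ' ≃ G_fix` via `Γ → G`, which gives an action of `G_fix` on `T'`, and
    -- `(ℂⁿ / Λ') / (Γ_fix / Λ') ≃ T' / G_fix`, induced by the identity of `T'`
    (∃ e : (liftsFix Λ G ⧸ fixTranslations Λ G) ≃* groupFix Λ G,
      (∀ γ : liftsFix Λ G, IsLift Λ (e γ : G) γ) ∧
      ∃ _ : MulAction (groupFix Λ G) (FixTorus Λ G),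
        (∀ (γ : liftsFix Λ G) (z : Cn n), e γ • (z : FixTorus Λ G) = (γ.1 z : Cn n)) ∧
        ∃ h₂ : OrbitSpace (liftsFix Λ G ⧸ fixTranslations Λ G) (FixTorus Λ G) ≃ₜ
            OrbitSpace (groupFix Λ G) (FixTorus Λ G),
          ∀ x : FixTorus Λ G, h₂ (orbitMk (liftsFix Λ G ⧸ fixTranslations Λ G) x) =
            orbitMk (groupFix Λ G) x) ∧
    -- compactness of the universal cover
    (CompactSpace (OrbitSpace (liftsFix Λ G) (Cn n)) ↔
      IsCrystallographicGroup (liftsFix Λ G)) ∧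
    (CompactSpace (OrbitSpace (liftsFix Λ G) (Cn n)) ↔ CompactSpace (FixTorus Λ G)) ∧
    -- the fundamental group
    ((∃ g ∈ groupFix Λ G, ∀ γ : Cn n ≃ₜ Cn n, IsLift Λ g γ → γ ∈ liftsFix Λ G) →
      (∀ v ∈ Λ, Homeomorph.addRight v ∈ liftsFix Λ G) ∧
      ∀ x : OrbitSpace G (Cn n ⧸ Λ),
        Nonempty (FundamentalGroup (OrbitSpace G (Cn n ⧸ Λ)) x ≃* G ⧸ groupFix Λ G)) := by
  have hc : ∀ g : G, Continuous fun x : Cn n ⧸ Λ => g • x := fun g => (hol g).continuous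
  have hlift : ∀ g : G, ∃ γ, IsLift Λ g γ := exists_isLift hc
  have hslice := exists_slice_lifts hΛ hol
  have hcov := isQuotientCoveringMap_coverMap hlift hc hslice
  have hsc : SimplyConnectedSpace (OrbitSpace (liftsFix Λ G) (Cn n)) :=
    simplyConnectedSpace_liftsFix (fun _ ⟨_, hg⟩ => hg.exists_affine hΛ hol) hslice
  obtain ⟨e, he⟩ := exists_mulEquiv_groupFix hlift
  have : Finite (liftsFix Λ G ⧸ fixTranslations Λ G) := Finite.of_equiv _ e.symm.toEquiv
  refine ⟨⟨hsc, hcov.isCoveringMap, hcov.surjective⟩, exists_homeomorph_orbitSpace_fixTorus,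
    ⟨e, he, MulAction.compHom _ e.symm.toMonoidHom, fun γ z => ?_, exists_homeomorph_compHom e⟩,
    ⟨fun _ => isCrystallographicGroup_liftsFix hΛ hol, fun h => h.compactSpace_orbitSpace⟩,
    compactSpace_orbitSpace_iff_compactSpace_fixTorus, ?_⟩
  · change e.symm (e γ) • (z : FixTorus Λ G) = _
    rw [e.symm_apply_apply, fixTorusAction_mk]
  · rintro ⟨g, -, hg⟩
    have hv : ∀ v ∈ Λ, Homeomorph.addRight v ∈ liftsFix Λ G := fun v hv =>
      addRight_mem_liftsFix_of_lifts_le hlift hg hv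
    refine ⟨hv, fun x => ?_⟩
    obtain ⟨y, hy⟩ := hcov.surjective x
    obtain ⟨k⟩ := nonempty_lifts_quotient_mulEquiv hlift hv
    -- The covering yields the opposite of the deck group; inversion identifies it with the deck
    -- group itself.
    exact ⟨(hcov.fundamentalGroupEquiv ⟨y, hy⟩).trans ((MulEquiv.inv' _).symm.trans k)⟩
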